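/- Consider the linear system $X(t+1)=AX(t)+V(t)\in\mathbb R^{n_x}$, $Y(t)=CX(t)+W(t)\in\mathbb R^{n_y}$, $t\in\mathbb N_0$, where $(C,A)$ is observable and $A$ has at least one eigenvalue of modulus greater than one. The disturbance signals $V=(V(t))_t$ and $W=(W(t))_t$ take values in given sets of sequences (their ranges), each of which is uniformly bounded (over all its members and all times) and contains the zero sequence; let $h_{lin}=\sum_{|\lambda_i|\ge 1}\log_q|\lambda_i|$, the sum being over the eigenvalues of $A$ counted with multiplicity. Let $\mathcal X$ be a finite commutative group (for example $\mathbb Z/q$) with $q=|\mathcal X|\ge 2$ elements and operation $\oplus$. A finite-state additive noise channel maps an input sequence $D(t)\in\mathcal X$ to $Q(t)=D(t)\oplus Z(t)$, where $Z$ is the sequence of edge labels along an arbitrary infinite walk, from an arbitrary unknown initial state, in a finite nonempty directed graph with at most one edge for each ordered pair of vertices (every two vertices, including equal ones, being joined by a walk of positive length) whose edges are labelled by elements of $\mathcal X$, with distinct labels on distinct edges leaving the same vertex. Let $h_{ch}=\log_q\lambda$, where $\lambda$ is the Perron eigenvalue (spectral radius) of the $0/1$ adjacency matrix of the graph. The initial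 state $X(0)$, the signals $V$ and $W$, and the channel noise $Z$ are mutually unrelated: all combinations of their possible realizations can occur. A coder-estimator consists of maps $D(t)=\zeta(t,Y(0),\dots,Y(t))\in\mathcal X$ and $\hat X(t+1)=\eta(t,Q(0),\dots,Q(t))\in\mathbb R^{n_x}$, with $\hat X(0)=0$. It yields uniformly bounded estimation errors if for all such ranges of $V$ and $W$ there is $l>0$ such that, for every range of $X(0)$ contained in $\{x:\|x\|\le l\}$, $\sup\|X(t)-\hat X(t)\|<\infty$, the supremum being over all $t$ and all realizations of $X(0)$, $V$, $W$, $Z$. (i) If $h_{lin}+2h_{ch}<1$, then there is a coder-estimator that yields uniformly bounded estimation errors. (ii) If $h_{lin}+h_{ch}>1$, then for every coder-estimator, all such ranges of $V$ and $W$, and every $l>0$, there are disturbance sequences $v$ and $w$ in these ranges, an initial state $x_0$ with $\|x_0\|\le l$ and a channel noise sequence $z$ for which the estimation error is unbounded: $\sup_t\|X(t)-\hat X(t)\|=\infty$. -/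

import Mathlib

noncomputable section

namespace FSEstimation

/-! ### The linear system -/

/-- The matrices of the system `X (t+1) = A X t + V t`, `Y t = C X t + W t`,
with state space `ℝ^nx` and output space `ℝ^ny`.  Only boundedness of norms matters below, so the
norm on `ℝ^n` (here the maximum norm of `Fin n → ℝ`) can be replaced by any other one. -/
structure LTISystem (nx ny : ℕ) where
  A : Matrix (Fin nx) (Fin nx) ℝ
  C : Matrix (Fin ny) (Fin nx) ℝ

namespace LTISystem

variable {nx ny : ℕ} (P : LTISystem nx ny)

/-- Observability of `(C, A)`: the undisturbed outputs `C A^k x` determine the initial state. -/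
def Observable : Prop :=
  ∀ x : Fin nx → ℝ, (∀ k : ℕ, P.C.mulVec ((P.A ^ k).mulVec x) = 0) → x = 0

/-- The complex eigenvalues of `A`, with algebraic multiplicity. -/
def eigenvalues : Multiset ℂ := (P.A.map ((↑) : ℝ → ℂ)).charpoly.roots

/-- `A` has an eigenvalue of modulus greater than one. -/
def HasUnstableEigenvalue : Prop := ∃ μ ∈ P.eigenvalues, 1 < ‖μ‖

open Classical in
/-- Topological entropy of the linear system in base `q`: the sum of `log_q |μ|` over the
eigenvalues `μ` with `|μ| ≥ 1`, with multiplicity. -/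
def entropy (q : ℕ) : ℝ :=
  ((P.eigenvalues.filter (fun μ => 1 ≤ ‖μ‖)).map (fun μ => Real.logb q ‖μ‖)).sum

/-- State trajectory for initial state `x₀` and process disturbance `v`. -/
def state (x₀ : Fin nx → ℝ) (v : ℕ → Fin nx → ℝ) : ℕ → Fin nx → ℝ
  | 0 => x₀
  | t + 1 => P.A.mulVec (state x₀ v t) + v t

/-- Measured output for initial state `x₀`, process disturbance `v`, measurement disturbance `w`. -/
def output (x₀ : Fin nx → ℝ) (v : ℕ → Fin nx → ℝ) (w : ℕ → Fin ny → ℝ) (t : ℕ) : Fin ny → ℝ :=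
  P.C.mulVec (P.state x₀ v t) + w t

end LTISystem

/-- Admissible range (set of possible realizations) of a disturbance signal: it is uniformly
bounded over all realizations and all times, and contains the zero signal. -/
def AdmissibleRange {n : ℕ} (R : Set (ℕ → Fin n → ℝ)) : Prop :=
  0 ∈ R ∧ ∃ b : ℝ, ∀ v ∈ R, ∀ t, ‖v t‖ ≤ b

/-! ### The channel -/

/-- A finite-state additive noise channel with state set `S` and alphabet `X`.  The noise is
governed by a strongly connected directed graph on `S`; the edge `s → s'` carries the noise value
`label s s'`, and distinct edges leaving the same state carry distinct values.  (`TransGen` asks for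
walks of positive length: a one-state graph must have its loop, otherwise no noise sequence exists.)
The value of `label` at a non-edge is irrelevant. -/
structure AdditiveNoiseChannel (S X : Type*) where
  Edge : S → S → Prop
  label : S → S → X
  label_injective : ∀ s s₁ s₂, Edge s s₁ → Edge s s₂ → label s s₁ = label s s₂ → s₁ = s₂
  strongly_connected : ∀ s s', Relation.TransGen Edge s s'

namespace AdditiveNoiseChannel

variable {S X : Type*} (K : AdditiveNoiseChannel S X)

open Classical in
/-- Adjacency matrix of the state transition graph. -/
def adjacency : Matrix S S ℂ := Matrix.of fun s s' => if K.Edge s s' then 1 else 0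

/-- The Perron eigenvalue of the adjacency matrix: its largest eigenvalue in modulus. -/
def perronEigenvalue [Fintype S] [DecidableEq S] : ℝ := (spectralRadius ℂ K.adjacency).toReal

/-- Topological entropy of the channel, in base `q = |X|`. -/
def entropy [Fintype S] [DecidableEq S] [Fintype X] : ℝ :=
  Real.logb (Fintype.card X) K.perronEigenvalue

/-- `z` is a noise sequence of the channel: the labels along an infinite walk from some state. -/
def IsNoise (z : ℕ → X) : Prop :=
  ∃ s : ℕ → S, ∀ t, K.Edge (s t) (s (t + 1)) ∧ z t = K.label (s t) (s (t + 1))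

end AdditiveNoiseChannel

/-! ### Coding and estimation over the channel -/

/-- A causal coder `D t = ζ (t, Y (0:t))` and a causal estimator `X̂ (t+1) = η (t, Q (0:t))`. -/
structure CoderEstimator (nx ny : ℕ) (X : Type*) where
  coder : (t : ℕ) → (Fin (t + 1) → Fin ny → ℝ) → X
  estimator : (t : ℕ) → (Fin (t + 1) → X) → Fin nx → ℝ

namespace CoderEstimator

variable {nx ny : ℕ} {X : Type*} (F : CoderEstimator nx ny X)

/-- Channel input when the plant output is `y`. -/
def channelInput (y : ℕ → Fin ny → ℝ) (t : ℕ) : X := F.coder t (fun i => y i)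

/-- Channel output when the plant output is `y` and the channel noise is `z`. -/
def channelOutput [Add X] (y : ℕ → Fin ny → ℝ) (z : ℕ → X) (t : ℕ) : X :=
  F.channelInput y t + z t

/-- State estimate computed from the received sequence `r`, with `X̂ 0 = 0`. -/
def estimate (r : ℕ → X) : ℕ → Fin nx → ℝ
  | 0 => 0
  | t + 1 => F.estimator t (fun i => r i)

/-- Estimation error `X t - X̂ t` for initial state `x₀`, process disturbance `v`, measurement
disturbance `w` and channel noise `z`. -/
def error [Add X] (P : LTISystem nx ny) (x₀ : Fin nx → ℝ) (v : ℕ → Fin nx → ℝ)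
    (w : ℕ → Fin ny → ℝ) (z : ℕ → X) (t : ℕ) : Fin nx → ℝ :=
  P.state x₀ v t - F.estimate (F.channelOutput (P.output x₀ v w) z) t

/-- Uniformly bounded estimation errors: for all admissible disturbance ranges there is `l > 0` such
that for every range of the initial state in the `l`-ball the error is bounded over all times and
realizations.  Initial state, disturbances and channel noise are mutually unrelated, that is, every
combination of realizations from their ranges can occur. -/
def UniformlyBounded {S : Type*} [Add X] (P : LTISystem nx ny) (K : AdditiveNoiseChannel S X) :
    Prop :=
  ∀ (𝒱 : Set (ℕ → Fin nx → ℝ)) (𝒲 : Set (ℕ → Fin ny → ℝ)),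
    AdmissibleRange 𝒱 → AdmissibleRange 𝒲 →
    ∃ l : ℝ, 0 < l ∧ ∀ R₀ : Set (Fin nx → ℝ), R₀ ⊆ Metric.closedBall 0 l →
      ∃ M : ℝ, ∀ x₀ ∈ R₀, ∀ v ∈ 𝒱, ∀ w ∈ 𝒲, ∀ z : ℕ → X, K.IsNoise z →
        ∀ t, ‖F.error P x₀ v w z t‖ ≤ M

end CoderEstimator

end FSEstimation

end

/-! Both halves compare exponential growth rates. Let Δ be the product of max(1, |λ|) over the
eigenvalues, so that Δ = q^h_lin, and let Λ = q^h_ch. The noise words of length T number about Λ^T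
(`exists_growth_pow_le`, `exists_card_words_le`). Up to subexponential factors, Δ^k is both the
number of unit-scale cells needed to cover A^k(unit ball) (`card_separated_image_le`) and a lower
bound for how many points of a set of positive outer measure A^k can drive apart
(`exists_separated_image`). Both facts rest on `exists_unstable_idempotent`, which isolates the
unstable part of A as a polynomial in A and reduces the counts to volume comparisons.

Converse: zero disturbances suffice. If the error were bounded for every initial state and noise, a
Baire argument over walks (`exists_prefix_bounded`) and countable subadditivity over initial states
would yield one bound valid on a set of positive outer measure, for all walks with a fixed prefix.
Then the received word determines the initial state among separated ones, hence the channel input,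
hence the noise. So about Δ^T Λ^T pairs inject into q^T words (`card_mul_card_words_le`), which
forces ΔΛ ≤ q.

Achievability: two codewords are confusable only if they differ by a difference of two noise words,
so a greedy code without confusion has about q^k / Λ^(2k) words. This is the origin of the factor 2.
When ΔΛ² < q, a long block carries every cell of a quantizer for A^k plus an overflow symbol
(`exists_block_quantizer`). Its cell size grows at each overflow, and overflows are bounded in
number for bounded disturbances (`exists_quantizer_error_le`), so the unknown disturbance bound does
no harm. Observability supplies state measurements with bounded error at the block starts. -/

namespace FSEstimation

open scoped Matrix.Norms.Operator Polynomial ENNReal NNReal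

/-! ### Spectral splitting of a real matrix and growth of its powers -/

section Spectral

open Polynomial Filter Topology

/-- Every nonzero real polynomial factors into a part whose complex roots have modulus at least one
and a part whose complex roots have modulus less than one. -/
theorem exists_mul_eq_of_root_norm (p : ℝ[X]) (hp : p ≠ 0) :
    ∃ u s : ℝ[X], u * s = p ∧ (∀ z : ℂ, aeval z u = 0 → 1 ≤ ‖z‖) ∧
      ∀ z : ℂ, aeval z s = 0 → ‖z‖ < 1 := by
  induction p using WfDvdMonoid.induction_on_irreducible with
  | zero => exact absurd rfl hp
  | unit v hv =>
    refine ⟨v, 1, mul_one v, fun z hz => ?_, fun z hz => by simp at hz⟩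
    have h := hv.map (aeval z)
    rw [hz] at h
    exact absurd h not_isUnit_zero
  | mul a i ha hi ih =>
    obtain ⟨u, s, hus, hu, hs⟩ := ih ha
    -- Roots of an irreducible real polynomial are conjugate under Gal(ℂ/ℝ), which preserves the
    -- modulus, so each irreducible factor goes wholly to one side.
    have hconj : ∀ z w : ℂ, aeval z i = 0 → aeval w i = 0 → ‖z‖ = ‖w‖ := by
      intro z w hz hw
      have hmin : minpoly ℝ z = minpoly ℝ w := by
        rw [← minpoly.eq_of_irreducible hi hz, ← minpoly.eq_of_irreducible hi hw]
      have : IsAlgClosure ℝ ℂ := ⟨inferInstance, inferInstance⟩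
      have : Normal ℝ ℂ := IsAlgClosure.normal ℝ ℂ
      obtain ⟨σ, hσ⟩ := IsConjRoot.exists_algEquiv (K := ℝ) (L := ℂ) hmin
      rcases Complex.real_algHom_eq_id_or_conj σ.toAlgHom with h | h
      · have := DFunLike.congr_fun h w
        simp at this
        rw [← hσ, this]
      · have := DFunLike.congr_fun h w
        simp at this
        rw [← hσ, this]
        simp
    by_cases hroot : ∃ z : ℂ, aeval z i = 0 ∧ 1 ≤ ‖z‖
    · obtain ⟨z, hz, hz1⟩ := hroot
      refine ⟨i * u, s, by rw [mul_assoc, hus], fun w hw => ?_, hs⟩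
      rw [map_mul, mul_eq_zero] at hw
      rcases hw with hw | hw
      · rwa [← hconj z w hz hw]
      · exact hu w hw
    · push Not at hroot
      refine ⟨u, i * s, by rw [← hus]; ring, hu, fun w hw => ?_⟩
      rw [map_mul, mul_eq_zero] at hw
      rcases hw with hw | hw
      · exact hroot w hw
      · exact hs w hw

variable {n : Type*} [Fintype n] [DecidableEq n]

/-- Both sides are multiplicative in f, so constants and linear factors suffice; for X - c the
determinant is the characteristic polynomial at c, up to sign. -/
theorem det_aeval_eq_prod_roots (M : Matrix n n ℂ) (f : ℂ[X]) :
    (aeval M f).det = (M.charpoly.roots.map fun z => f.eval z).prod := by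
  have hcard : M.charpoly.roots.card = Fintype.card n := by
    rw [← (IsAlgClosed.splits M.charpoly).natDegree_eq_card_roots, M.charpoly_natDegree_eq_dim]
  have hmul : ∀ g h : ℂ[X], (aeval M g).det = (M.charpoly.roots.map fun z => g.eval z).prod →
      (aeval M h).det = (M.charpoly.roots.map fun z => h.eval z).prod →
      (aeval M (g * h)).det = (M.charpoly.roots.map fun z => (g * h).eval z).prod := by
    intro g h hg hh
    simp only [map_mul, Matrix.det_mul, hg, hh, eval_mul, Multiset.prod_map_mul]
  have hlin : ∀ c : ℂ, (aeval M (X - C c)).det =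
      (M.charpoly.roots.map fun z => (X - C c).eval z).prod := by
    intro c
    have h1 : M.charpoly.eval c = (M.charpoly.roots.map fun z => c - z).prod := by
      conv_lhs => rw [(IsAlgClosed.splits M.charpoly).eq_prod_roots_of_monic M.charpoly_monic]
      rw [eval_multiset_prod, Multiset.map_map]
      simp
    have h2 : aeval M (X - C c) = -(Matrix.scalar n c - M) := by
      simp [Algebra.algebraMap_eq_smul_one, Matrix.smul_one_eq_diagonal]
    rw [h2, Matrix.det_neg, ← Matrix.eval_charpoly, h1, ← hcard]
    have h3 : (fun z : ℂ => (X - C c).eval z) = fun z => (-1) * (c - z) := by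
      funext z; simp
    rw [h3, Multiset.prod_map_mul]
    simp
  rw [(IsAlgClosed.splits f).eq_prod_roots]
  apply hmul
  · simp [Algebra.algebraMap_eq_smul_one, hcard]
  · induction f.roots using Multiset.induction_on with
    | empty => simp
    | cons c s ih =>
      rw [Multiset.map_cons, Multiset.prod_cons]
      exact hmul _ _ (hlin c) ih

theorem exists_eval_eq_of_mem_spectrum_aeval (M : Matrix n n ℂ) (f : ℂ[X]) {z : ℂ}
    (hz : z ∈ spectrum ℂ (aeval M f)) : ∃ w ∈ spectrum ℂ M, f.eval w = z := by
  rcases subsingleton_or_nontrivial (Matrix n n ℂ) with h | h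
  · simp [spectrum.of_subsingleton] at hz
  rw [spectrum.map_polynomial_aeval] at hz
  exact hz

/-- Powers grow at most geometrically, at any rate exceeding the spectral radius. -/
theorem exists_norm_pow_le {M : Matrix n n ℂ} {θ : ℝ} (hθ : spectralRadius ℂ M < ENNReal.ofReal θ) :
    ∃ C : ℝ, 0 < C ∧ ∀ k : ℕ, ‖M ^ k‖ ≤ C * θ ^ k := by
  have hθ0 : 0 < θ := by
    by_contra h
    rw [ENNReal.ofReal_of_nonpos (not_lt.mp h)] at hθ
    exact not_lt_bot hθ
  have h := (spectrum.pow_norm_pow_one_div_tendsto_nhds_spectralRadius M).eventually_lt_const hθ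
  obtain ⟨N, hN⟩ := eventually_atTop.mp (h.and (eventually_gt_atTop 0))
  have hlarge : ∀ k ≥ N, ‖M ^ k‖ ≤ θ ^ k := by
    intro k hk
    obtain ⟨h1, h2⟩ := hN k hk
    have h3 := ((ENNReal.ofReal_lt_ofReal_iff hθ0).mp h1).le
    have h4 := pow_le_pow_left₀ (by positivity) h3 k
    rwa [one_div, Real.rpow_inv_natCast_pow (norm_nonneg _) h2.ne'] at h4
  -- Gelfand's formula controls all exponents from N on; the sum absorbs the finitely many earlier
  -- ones.
  refine ⟨1 + ∑ k ∈ Finset.range N, ‖M ^ k‖ / θ ^ k, by positivity, fun k => ?_⟩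
  have hpos : 0 < θ ^ k := by positivity
  by_cases hk : k < N
  · have h1 : ‖M ^ k‖ / θ ^ k ≤ ∑ k ∈ Finset.range N, ‖M ^ k‖ / θ ^ k :=
      Finset.single_le_sum (f := fun k => ‖M ^ k‖ / θ ^ k) (fun i _ => by positivity)
        (Finset.mem_range.mpr hk)
    rw [← div_le_iff₀ hpos]
    linarith
  · have h0 : 0 ≤ ∑ k ∈ Finset.range N, ‖M ^ k‖ / θ ^ k :=
      Finset.sum_nonneg fun i _ => by positivity
    have := hlarge k (not_lt.mp hk)
    nlinarith

theorem norm_map_ofReal (M : Matrix n n ℝ) : ‖M.map ((↑) : ℝ → ℂ)‖ = ‖M‖ := by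
  rw [Matrix.linfty_opNorm_def, Matrix.linfty_opNorm_def]
  simp

theorem exists_norm_pow_le_of_spectrum {M : Matrix n n ℝ}
    (hM : ∀ z ∈ spectrum ℂ (M.map ((↑) : ℝ → ℂ)), ‖z‖ ≤ 1) {θ : ℝ} (hθ : 1 < θ) :
    ∃ C : ℝ, 0 < C ∧ ∀ k : ℕ, ‖M ^ k‖ ≤ C * θ ^ k := by
  have h : spectralRadius ℂ (M.map ((↑) : ℝ → ℂ)) < ENNReal.ofReal θ := by
    refine lt_of_le_of_lt (iSup₂_le fun z hz => ?_) (?_ : (1 : ℝ≥0∞) < _)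
    · exact_mod_cast hM z hz
    · simpa using hθ
  obtain ⟨C, hC, hb⟩ := exists_norm_pow_le h
  refine ⟨C, hC, fun k => ?_⟩
  have hk := hb k
  have : (M.map ((↑) : ℝ → ℂ)) ^ k = (M ^ k).map ((↑) : ℝ → ℂ) :=
    ((Complex.ofRealHom.mapMatrix (m := n)).map_pow M k).symm
  rwa [this, norm_map_ofReal] at hk

/-- The unstable part of a real matrix: an idempotent `E` commuting with `A` such that
`H = A E + (1 - E)` has determinant of modulus `∏ max (1, |λ|)`, while `H⁻¹` and `A (1 - E)` have
subexponential growth. -/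
theorem exists_unstable_idempotent (A : Matrix n n ℝ) :
    ∃ E H : Matrix n n ℝ, E * E = E ∧ Commute A E ∧ H = A * E + (1 - E) ∧
      |H.det| = ((A.map ((↑) : ℝ → ℂ)).charpoly.roots.map fun z => max 1 ‖z‖).prod ∧
      (∀ θ : ℝ, 1 < θ → ∃ C : ℝ, 0 < C ∧ ∀ k : ℕ, ‖H⁻¹ ^ k‖ ≤ C * θ ^ k) ∧
      (∀ θ : ℝ, 1 < θ → ∃ C : ℝ, 0 < C ∧ ∀ k : ℕ, ‖(A * (1 - E)) ^ k‖ ≤ C * θ ^ k) := by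
  obtain ⟨u, s, hus, hu, hs⟩ := exists_mul_eq_of_root_norm A.charpoly A.charpoly_monic.ne_zero
  have hcop : IsCoprime u s := by
    rw [← isCoprime_map (algebraMap ℝ ℂ)]
    apply isCoprime_of_irreducible_dvd
    · rintro ⟨h, -⟩
      rw [Polynomial.map_eq_zero] at h
      rw [h, zero_mul] at hus
      exact A.charpoly_monic.ne_zero hus.symm
    · intro q hq hqu hqs
      obtain ⟨z, hz⟩ := IsAlgClosed.exists_root q hq.degree_pos.ne'
      have h1 := hu z (by rw [aeval_def, eval₂_eq_eval_map]; exact hz.dvd hqu)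
      have h2 := hs z (by rw [aeval_def, eval₂_eq_eval_map]; exact hz.dvd hqs)
      linarith
  obtain ⟨a, b, hab⟩ := hcop
  -- By the Bézout identity, e is 1 at the roots of u and 0 at those of s, and e(1 - e) is a
  -- multiple of the characteristic polynomial, so e(A) is idempotent.
  set e : ℝ[X] := b * s with he
  set f : ℝ[X] := X * e + (1 - e) with hf
  set g : ℝ[X] := X * (1 - e) with hg
  have h1e : 1 - e = a * u := by rw [he, ← hab]; ring
  have hee : aeval A (e * (1 - e)) = 0 := by
    have : e * (1 - e) = a * b * A.charpoly := by rw [h1e, ← hus]; ring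
    rw [this, map_mul, Matrix.aeval_self_charpoly, mul_zero]
  have hmap : ∀ p : ℝ[X], (aeval A p).map ((↑) : ℝ → ℂ) =
      aeval (A.map ((↑) : ℝ → ℂ)) (p.map (algebraMap ℝ ℂ)) := by
    intro p
    have := Polynomial.map_aeval_eq_aeval_map (φ := algebraMap ℝ ℂ)
      (ψ := (Complex.ofRealHom.mapMatrix (m := n))) (by
        ext r i j
        simp only [Algebra.algebraMap_eq_smul_one, RingHom.comp_apply, RingHom.mapMatrix_apply,
          Matrix.map_apply, Matrix.smul_apply, Matrix.one_apply]
        split_ifs <;> simp) p A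
    exact this
  have hroot : ∀ z : ℂ, z ∈ (A.map ((↑) : ℝ → ℂ)).charpoly.roots →
      (aeval z u = 0 ∨ aeval z s = 0) := by
    intro z hz
    have h := (mem_roots'.mp hz).2
    have hcp : (A.map ((↑) : ℝ → ℂ)).charpoly = A.charpoly.map (algebraMap ℝ ℂ) :=
      Matrix.charpoly_map A Complex.ofRealHom
    rw [hcp, IsRoot, ← eval₂_eq_eval_map, ← aeval_def, ← hus, map_mul, mul_eq_zero] at h
    exact h
  have heval : ∀ z : ℂ, z ∈ (A.map ((↑) : ℝ → ℂ)).charpoly.roots →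
      (1 ≤ ‖z‖ ∧ aeval z e = 1) ∨ (‖z‖ < 1 ∧ aeval z e = 0) := by
    intro z hz
    rcases hroot z hz with h | h
    · left
      refine ⟨hu z h, ?_⟩
      have : e = 1 - a * u := by rw [← h1e]; ring
      rw [this]; simp [h]
    · right
      refine ⟨hs z h, ?_⟩
      rw [he]; simp [h]
  -- At a root z, f takes the value z on the unstable side and 1 on the stable side. This gives the
  -- determinant of f(A) and bounds the spectrum of its inverse.
  have hfz : ∀ z : ℂ, z ∈ (A.map ((↑) : ℝ → ℂ)).charpoly.roots →
      ‖(f.map (algebraMap ℝ ℂ)).eval z‖ = max 1 ‖z‖ := by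
    intro z hz
    rw [← eval₂_eq_eval_map, ← aeval_def, hf]
    rcases heval z hz with ⟨h1, h2⟩ | ⟨h1, h2⟩
    · simp [h2, max_eq_right h1]
    · simp [h2, max_eq_left h1.le]
  have hdet : |(aeval A f).det| =
      ((A.map ((↑) : ℝ → ℂ)).charpoly.roots.map fun z => max 1 ‖z‖).prod := by
    have h1 : (((aeval A f).det : ℝ) : ℂ) = ((aeval A f).map ((↑) : ℝ → ℂ)).det :=
      RingHom.map_det Complex.ofRealHom _
    have h2 : |(aeval A f).det| = ‖(((aeval A f).det : ℝ) : ℂ)‖ := by simp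
    rw [h2, h1, hmap, det_aeval_eq_prod_roots]
    rw [← Multiset.map_congr rfl hfz]
    generalize (A.map ((↑) : ℝ → ℂ)).charpoly.roots = m
    induction m using Multiset.induction_on with
    | empty => simp
    | cons c m ih => simp only [Multiset.map_cons, Multiset.prod_cons, norm_mul, ih]
  have hspec : ∀ z : ℂ, z ∈ spectrum ℂ (A.map ((↑) : ℝ → ℂ)) →
      z ∈ (A.map ((↑) : ℝ → ℂ)).charpoly.roots := by
    intro z hz
    rw [Matrix.mem_spectrum_iff_isRoot_charpoly] at hz
    exact (mem_roots (Matrix.charpoly_monic _).ne_zero).mpr hz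
  have hdet1 : 1 ≤ |(aeval A f).det| := by
    rw [hdet]
    generalize (A.map ((↑) : ℝ → ℂ)).charpoly.roots = m
    induction m using Multiset.induction_on with
    | empty => simp
    | cons c m ih =>
      rw [Multiset.map_cons, Multiset.prod_cons]
      exact one_le_mul_of_one_le_of_one_le (le_max_left _ _) ih
  have hunit : IsUnit (aeval A f).det := by
    rw [isUnit_iff_ne_zero]
    intro h
    rw [h] at hdet1
    norm_num at hdet1
  refine ⟨aeval A e, aeval A f, ?_, ?_, ?_, hdet, fun θ hθ => ?_, fun θ hθ => ?_⟩
  · simp only [map_mul, map_sub, mul_sub, mul_one] at hee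
    exact (sub_eq_zero.mp hee).symm
  · have := (Commute.all X e).map (aeval A : ℝ[X] →ₐ[ℝ] Matrix n n ℝ)
    simpa using this
  · simp [hf]
  · apply exists_norm_pow_le_of_spectrum _ hθ
    intro z hz
    have h1 : ((aeval A f)⁻¹).map ((↑) : ℝ → ℂ) = ((aeval A f).map ((↑) : ℝ → ℂ))⁻¹ := by
      symm
      apply Matrix.inv_eq_left_inv
      have := congrArg (Complex.ofRealHom.mapMatrix (m := n)) (Matrix.nonsing_inv_mul _ hunit)
      rw [map_mul, map_one] at this
      exact this
    have hunit' : IsUnit ((aeval A f).map ((↑) : ℝ → ℂ)) := by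
      have := ((Matrix.isUnit_iff_isUnit_det _).mpr hunit).map (Complex.ofRealHom.mapMatrix (m := n))
      exact this
    obtain ⟨v, hv⟩ := hunit'
    rw [h1, ← hv, ← Matrix.coe_units_inv] at hz
    have hz0 : z ≠ 0 := spectrum.ne_zero_of_mem_of_unit hz
    have hz' : z⁻¹ ∈ spectrum ℂ (v : Matrix n n ℂ) := by
      have := (spectrum.inv_mem_iff (r := Units.mk0 z hz0) (a := v⁻¹)).mp hz
      simpa using this
    rw [hv, hmap] at hz'
    obtain ⟨w, hw, hwz⟩ := exists_eval_eq_of_mem_spectrum_aeval _ _ hz'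
    have h2 := hfz w (hspec w hw)
    rw [hwz, norm_inv] at h2
    have h3 : 1 ≤ ‖z‖⁻¹ := h2 ▸ le_max_left _ _
    exact (one_le_inv₀ (norm_pos_iff.mpr hz0)).mp h3
  · apply exists_norm_pow_le_of_spectrum _ hθ
    intro z hz
    have : A * (1 - aeval A e) = aeval A g := by simp [hg]
    rw [this, hmap] at hz
    obtain ⟨w, hw, hwz⟩ := exists_eval_eq_of_mem_spectrum_aeval _ _ hz
    rw [← hwz, ← eval₂_eq_eval_map, ← aeval_def, hg]
    rcases heval w (hspec w hw) with ⟨h1, h2⟩ | ⟨h1, h2⟩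
    · simp [h2]
    · simp [h2, h1.le]

end Spectral

/-! ### Greedy packing and covering -/

/-- Greedy alternative: a set contains `N` mutually far points, or fewer than `N` of its points
are such that every point of the set is near one of them. -/
theorem exists_separated_or_cover {α : Type*} {far : α → α → Prop}
    (hsymm : ∀ x y, far x y → far y x) (hirr : ∀ x, ¬ far x x) (G : Set α) (N : ℕ) :
    (∃ P : Finset α, (P : Set α) ⊆ G ∧ P.card = N ∧ (P : Set α).Pairwise far) ∨
      ∃ P : Finset α, (P : Set α) ⊆ G ∧ P.card < N ∧ ∀ x ∈ G, ∃ p ∈ P, ¬ far p x := by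
  classical
  induction N with
  | zero => exact Or.inl ⟨∅, by simp⟩
  | succ N ih =>
    rcases ih with ⟨P, hPG, hP, hfar⟩ | ⟨P, hPG, hP, hcov⟩
    · by_cases h : ∃ x ∈ G, ∀ p ∈ P, far p x
      · obtain ⟨x, hxG, hx⟩ := h
        have hxP : x ∉ P := fun hxP => hirr x (hx x hxP)
        refine Or.inl ⟨insert x P, ?_, by rw [Finset.card_insert_of_notMem hxP, hP], ?_⟩
        · rw [Finset.coe_insert]
          exact Set.insert_subset hxG hPG
        · rw [Finset.coe_insert]
          exact hfar.insert fun p hp _ => ⟨hsymm _ _ (hx p hp), hx p hp⟩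
      · push Not at h
        exact Or.inr ⟨P, hPG, by omega, h⟩
    · exact Or.inr ⟨P, hPG, by omega, hcov⟩

/-- Splits a given rate slack θ among m factors. The root of order m + 1 in the proof also covers m
= 0. -/
theorem exists_one_lt_pow_le {θ : ℝ} (hθ : 1 < θ) (m : ℕ) : ∃ η : ℝ, 1 < η ∧ η ^ m ≤ θ := by
  refine ⟨θ ^ ((1 : ℝ) / (m + 1 : ℕ)), Real.one_lt_rpow hθ (by positivity), ?_⟩
  have h1 : 1 < θ ^ ((1 : ℝ) / (m + 1 : ℕ)) := Real.one_lt_rpow hθ (by positivity)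
  calc (θ ^ ((1 : ℝ) / (m + 1 : ℕ))) ^ m ≤ (θ ^ ((1 : ℝ) / (m + 1 : ℕ))) ^ (m + 1) :=
        pow_le_pow_right₀ h1.le (Nat.le_succ m)
    _ = θ := by
        rw [one_div]
        exact Real.rpow_inv_natCast_pow (by linarith) (Nat.succ_ne_zero m)

/-! ### Volume bounds for separated points under powers of a matrix -/

section Packing

open MeasureTheory

variable {n : Type*} [Fintype n] [DecidableEq n]

theorem volume_preimage_closedBall {H : Matrix n n ℝ} (hH : H.det ≠ 0) (x : n → ℝ) {r : ℝ}
    (hr : 0 ≤ r) :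
    volume ((fun y => H.mulVec y) ⁻¹' Metric.closedBall x r) =
      ENNReal.ofReal (|H.det|⁻¹ * (2 * r) ^ Fintype.card n) := by
  have h := Measure.addHaar_preimage_linearMap (μ := (volume : Measure (n → ℝ)))
    (f := Matrix.toLin' H) (by rwa [LinearMap.det_toLin']) (Metric.closedBall x r)
  rw [LinearMap.det_toLin', Real.volume_pi_closedBall _ hr, abs_inv,
    ← ENNReal.ofReal_mul (by positivity)] at h
  exact h

/-- The preimages under H of the cubes of radius 1/4 about the points are disjoint, have equal
volume, and lie in the ball of radius R. -/
theorem card_le_of_preimage_subset {H : Matrix n n ℝ} (hH : H.det ≠ 0) {P : Finset (n → ℝ)}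
    (hP : (P : Set (n → ℝ)).Pairwise fun x y => 1 / 2 < ‖x - y‖) {R : ℝ} (hR : 0 ≤ R)
    (hsub : ∀ x ∈ P, ∀ y, ‖H.mulVec y - x‖ ≤ 1 / 4 → ‖y‖ ≤ R) :
    (P.card : ℝ) ≤ |H.det| * (4 * R) ^ Fintype.card n := by
  have hdisj : (P : Set (n → ℝ)).PairwiseDisjoint
      fun x => (fun y => H.mulVec y) ⁻¹' Metric.closedBall x (1 / 4) := by
    intro x hx y hy hxy
    refine Set.disjoint_left.mpr fun z hzx hzy => ?_
    have h := hP hx hy hxy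
    simp only [Set.mem_preimage, Metric.mem_closedBall, dist_eq_norm] at hzx hzy
    have h2 : ‖x - y‖ ≤ ‖H.mulVec z - x‖ + ‖H.mulVec z - y‖ := by
      rw [norm_sub_rev _ x]
      exact norm_sub_le_norm_sub_add_norm_sub _ _ _
    linarith
  have hmeas : ∀ x ∈ P, MeasurableSet ((fun y => H.mulVec y) ⁻¹' Metric.closedBall x (1 / 4)) :=
    fun x _ => Metric.isClosed_closedBall.measurableSet.preimage
      (Continuous.matrix_mulVec continuous_const continuous_id).measurable
  have hunion := measure_biUnion_finset (μ := volume) hdisj hmeas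
  have hle : volume (⋃ x ∈ P, (fun y => H.mulVec y) ⁻¹' Metric.closedBall x (1 / 4)) ≤
      volume (Metric.closedBall (0 : n → ℝ) R) := by
    apply measure_mono
    refine Set.iUnion₂_subset fun x hx y hy => ?_
    simp only [Set.mem_preimage, Metric.mem_closedBall, dist_eq_norm] at hy
    simpa using hsub x hx y hy
  have hpos : 0 < |H.det| := abs_pos.mpr hH
  rw [hunion, Finset.sum_congr rfl fun x _ => volume_preimage_closedBall hH x (by norm_num),
    Finset.sum_const, nsmul_eq_mul, Real.volume_pi_closedBall _ hR, ← ENNReal.ofReal_natCast,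
    ← ENNReal.ofReal_mul (by positivity), ENNReal.ofReal_le_ofReal_iff (by positivity)] at hle
  have h4 : (4 * R) ^ Fintype.card n = (2 * R) ^ Fintype.card n * 2 ^ Fintype.card n := by
    rw [← mul_pow]; ring
  have h5 : ((2 : ℝ) * (1 / 4)) ^ Fintype.card n * 2 ^ Fintype.card n = 1 := by
    rw [← mul_pow]; norm_num
  calc (P.card : ℝ) = |H.det| * (P.card * (|H.det|⁻¹ * (2 * (1 / 4)) ^ Fintype.card n)) *
        2 ^ Fintype.card n := by
        have : |H.det| * (P.card * (|H.det|⁻¹ * (2 * (1 / 4)) ^ Fintype.card n)) *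
          2 ^ Fintype.card n = (|H.det| * |H.det|⁻¹) * P.card *
            ((2 * (1 / 4)) ^ Fintype.card n * 2 ^ Fintype.card n) := by ring
        rw [this, h5, mul_inv_cancel₀ hpos.ne']
        ring
    _ ≤ |H.det| * (2 * R) ^ Fintype.card n * 2 ^ Fintype.card n := by gcongr
    _ = _ := by rw [h4]; ring

theorem pow_mul_idempotent {A E H : Matrix n n ℝ} (hE : E * E = E) (hAE : Commute A E)
    (hH : H = A * E + (1 - E)) (k : ℕ) :
    A ^ k * E = H ^ k * E ∧ H ^ k * (1 - E) = 1 - E ∧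
      A ^ k * (1 - E) = (A * (1 - E)) ^ k * (1 - E) := by
  have hE' : (1 - E) * (1 - E) = 1 - E := by
    rw [sub_mul, one_mul, mul_sub, mul_one, hE, sub_self, sub_zero]
  have hEE : (1 - E) * E = 0 := by rw [sub_mul, one_mul, hE, sub_self]
  have hEE' : E * (1 - E) = 0 := by rw [mul_sub, mul_one, hE, sub_self]
  have h1 : H * E = A * E := by rw [hH, add_mul, mul_assoc, hE, hEE, add_zero]
  have h2 : H * (1 - E) = 1 - E := by rw [hH, add_mul, mul_assoc, hEE', hE', mul_zero, zero_add]
  have hA' : Commute A (1 - E) := (Commute.one_right A).sub_right hAE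
  have hHE : Commute H E := by
    rw [hH]
    exact (hAE.mul_left (Commute.refl E)).add_left ((Commute.one_left E).sub_left (Commute.refl E))
  induction k with
  | zero => simp
  | succ k ih =>
    obtain ⟨i1, i2, i3⟩ := ih
    refine ⟨?_, ?_, ?_⟩
    · rw [pow_succ', mul_assoc, i1, pow_succ', mul_assoc, (hHE.pow_left k).eq, ← mul_assoc,
        ← mul_assoc, h1]
    · rw [pow_succ, mul_assoc, h2, i2]
    · calc A ^ (k + 1) * (1 - E) = A ^ k * (1 - E) * A := by
            rw [pow_succ, mul_assoc, hA'.eq, mul_assoc]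
        _ = (A * (1 - E)) ^ k * (A * (1 - E)) := by rw [i3, mul_assoc, hA'.eq]
        _ = (A * (1 - E)) ^ (k + 1) * (1 - E) := by
            rw [pow_succ, mul_assoc, mul_assoc A, hE']

/-- The modulus of the determinant of the unstable part of `A`. -/
noncomputable def unstableDet (A : Matrix n n ℝ) : ℝ :=
  ((A.map ((↑) : ℝ → ℂ)).charpoly.roots.map fun z => max 1 ‖z‖).prod

theorem one_le_unstableDet (A : Matrix n n ℝ) : 1 ≤ unstableDet A := by
  unfold unstableDet
  generalize (A.map ((↑) : ℝ → ℂ)).charpoly.roots = m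
  induction m using Multiset.induction_on with
  | empty => simp
  | cons c m ih =>
    rw [Multiset.map_cons, Multiset.prod_cons]
    exact one_le_mul_of_one_le_of_one_le (le_max_left _ _) ih

/-- H^(-k) A^k has subexponential norm: it is E on the unstable part and a product of two
subexponential powers on the stable part. Hence pulling the points back by H^k lands in a
subexponentially large ball, and the packing bound with det H^k = ±Δ^k applies. -/
theorem card_separated_image_le (A : Matrix n n ℝ) {θ : ℝ} (hθ : 1 < θ) :
    ∃ K : ℝ, 0 < K ∧ ∀ (k : ℕ) (P : Finset (n → ℝ)),
      (∀ x ∈ P, ∃ b : n → ℝ, ‖b‖ ≤ 1 ∧ x = (A ^ k).mulVec b) →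
      ((P : Set (n → ℝ)).Pairwise fun x y => 1 / 2 < ‖x - y‖) →
      (P.card : ℝ) ≤ K * (θ * unstableDet A) ^ k := by
  obtain ⟨E, H, hE, hAE, hH, hdet, hHinv, hst⟩ := exists_unstable_idempotent A
  change |H.det| = unstableDet A at hdet
  -- The radius of the enclosing ball grows like η^(2k), and its volume takes this to the power of
  -- the dimension.
  obtain ⟨η, hη, hηθ⟩ := exists_one_lt_pow_le hθ (2 * Fintype.card n)
  obtain ⟨C₁, hC₁, hb₁⟩ := hHinv η hη
  obtain ⟨C₂, hC₂, hb₂⟩ := hst η hη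
  have hdet0 : H.det ≠ 0 := by
    have := one_le_unstableDet A
    intro h
    rw [h, abs_zero] at hdet
    linarith
  set B : ℝ := C₁ + ‖E‖ + C₁ * C₂ * ‖1 - E‖ with hB
  have hBpos : 0 < B := by positivity
  refine ⟨(4 * B) ^ Fintype.card n, by positivity, fun k P hPA hP => ?_⟩
  have hdetk : (H ^ k).det ≠ 0 := by rw [Matrix.det_pow]; exact pow_ne_zero _ hdet0
  have hinv : H⁻¹ ^ k * H ^ k = 1 := by
    have hu : IsUnit H.det := isUnit_iff_ne_zero.mpr hdet0
    have hc : Commute H⁻¹ H :=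
      (Matrix.nonsing_inv_mul _ hu).trans (Matrix.mul_nonsing_inv _ hu).symm
    rw [← hc.mul_pow, Matrix.nonsing_inv_mul _ hu, one_pow]
  obtain ⟨e1, e2, e3⟩ := pow_mul_idempotent hE hAE hH k
  have hηk : 1 ≤ η ^ k := one_le_pow₀ hη.le
  have h := card_le_of_preimage_subset hdetk hP (R := B * (η ^ k * η ^ k)) (by positivity) (by
    intro x hx y hy
    obtain ⟨b, hb, rfl⟩ := hPA x hx
    have hdecomp : H⁻¹ ^ k * A ^ k = E + H⁻¹ ^ k * (A * (1 - E)) ^ k * (1 - E) := by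
      have : A ^ k = A ^ k * E + A ^ k * (1 - E) := by rw [← mul_add]; simp
      rw [this, e1, e3, mul_add, ← mul_assoc, hinv, one_mul, mul_assoc]
    have hnorm : ‖H⁻¹ ^ k * A ^ k‖ ≤ ‖E‖ + C₁ * η ^ k * (C₂ * η ^ k) * ‖1 - E‖ := by
      rw [hdecomp]
      refine (norm_add_le _ _).trans (add_le_add_right ?_ _)
      refine (norm_mul_le _ _).trans (mul_le_mul_of_nonneg_right ?_ (norm_nonneg _))
      exact (norm_mul_le _ _).trans (mul_le_mul (hb₁ k) (hb₂ k) (norm_nonneg _) (by positivity))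
    have hy' : y = (H⁻¹ ^ k).mulVec ((H ^ k).mulVec y - (A ^ k).mulVec b) +
        (H⁻¹ ^ k * A ^ k).mulVec b := by
      rw [Matrix.mulVec_sub, Matrix.mulVec_mulVec, Matrix.mulVec_mulVec, hinv]
      simp
    have n1 : ‖(H⁻¹ ^ k).mulVec ((H ^ k).mulVec y - (A ^ k).mulVec b)‖ ≤ C₁ * η ^ k * (1 / 4) :=
      (Matrix.linfty_opNorm_mulVec _ _).trans
        (mul_le_mul (hb₁ k) hy (norm_nonneg _) (by positivity))
    have n2 : ‖(H⁻¹ ^ k * A ^ k).mulVec b‖ ≤ (‖E‖ + C₁ * η ^ k * (C₂ * η ^ k) * ‖1 - E‖) * 1 :=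
      (Matrix.linfty_opNorm_mulVec _ _).trans
        (mul_le_mul hnorm hb (norm_nonneg _) (by positivity))
    have n3 : ‖y‖ ≤ C₁ * η ^ k * (1 / 4) +
        (‖E‖ + C₁ * η ^ k * (C₂ * η ^ k) * ‖1 - E‖) * 1 := by
      conv_lhs => rw [hy']
      exact (norm_add_le _ _).trans (add_le_add n1 n2)
    have n4 : C₁ * η ^ k * (1 / 4) ≤ C₁ * (η ^ k * η ^ k) := by
      have : η ^ k * (1 / 4) ≤ η ^ k * η ^ k := by nlinarith
      nlinarith
    have n5 : ‖E‖ ≤ ‖E‖ * (η ^ k * η ^ k) :=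
      le_mul_of_one_le_right (norm_nonneg _) (one_le_mul_of_one_le_of_one_le hηk hηk)
    calc ‖y‖ ≤ _ := n3
      _ ≤ C₁ * (η ^ k * η ^ k) + (‖E‖ * (η ^ k * η ^ k) +
          C₁ * η ^ k * (C₂ * η ^ k) * ‖1 - E‖) := by linarith
      _ = _ := by rw [hB]; ring)
  have hfin : (η ^ k * η ^ k) ^ Fintype.card n ≤ θ ^ k := by
    calc (η ^ k * η ^ k) ^ Fintype.card n = (η ^ (2 * Fintype.card n)) ^ k := by
          rw [← pow_add, ← pow_mul, ← pow_mul, ← two_mul, mul_right_comm]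
      _ ≤ θ ^ k := pow_le_pow_left₀ (by positivity) hηθ k
  have hdet1 := one_le_unstableDet A
  calc (P.card : ℝ) ≤ _ := h
    _ = unstableDet A ^ k * ((4 * B) ^ Fintype.card n * (η ^ k * η ^ k) ^ Fintype.card n) := by
        rw [Matrix.det_pow, abs_pow, hdet, ← mul_pow (4 * B), mul_assoc 4 B]
    _ ≤ unstableDet A ^ k * ((4 * B) ^ Fintype.card n * θ ^ k) := by gcongr
    _ = _ := by rw [mul_pow]; ring

/-- If too few points existed, a greedy cover would place G in few sets on each of which H^k stays
within κ of a centre, each of volume (2κ)^n / Δ^k; together they are too small for G. Only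
monotonicity and subadditivity of volume enter, so G need not be measurable. -/
theorem exists_separated_image (A : Matrix n n ℝ) {G : Set (n → ℝ)} {l : ℝ}
    (hGl : G ⊆ Metric.closedBall 0 l) (hG : volume G ≠ 0) {R : ℝ} (hR : 0 < R) :
    ∃ c : ℝ, 0 < c ∧ ∀ k : ℕ, ∃ P : Finset (n → ℝ), (P : Set (n → ℝ)) ⊆ G ∧
      c * unstableDet A ^ k ≤ P.card ∧
      (P : Set (n → ℝ)).Pairwise fun x y => R < ‖(A ^ k).mulVec (x - y)‖ := by
  obtain ⟨E, H, hE, hAE, hH, hdet, -, -⟩ := exists_unstable_idempotent A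
  change |H.det| = unstableDet A at hdet
  have hdet1 := one_le_unstableDet A
  have hdet0 : H.det ≠ 0 := by
    intro h
    rw [h, abs_zero] at hdet
    linarith
  -- As H^k = E A^k + (1 - E), this bounds H^k(p - x) whenever A^k(p - x) has norm at most R and p,
  -- x lie in the l-ball.
  set κ : ℝ := 1 + ‖E‖ * R + ‖1 - E‖ * (2 * |l|) with hκ
  have hκpos : 0 < κ := by positivity
  have hGfin : volume G ≠ ⊤ :=
    ((measure_mono hGl).trans_lt Metric.isBounded_closedBall.measure_lt_top).ne
  have hGpos : 0 < (volume G).toReal := ENNReal.toReal_pos hG hGfin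
  refine ⟨(volume G).toReal / (2 * κ) ^ Fintype.card n, by positivity, fun k => ?_⟩
  have hdetk : (H ^ k).det ≠ 0 := by rw [Matrix.det_pow]; exact pow_ne_zero _ hdet0
  obtain ⟨e1, e2, -⟩ := pow_mul_idempotent hE hAE hH k
  rcases exists_separated_or_cover (far := fun x y => R < ‖(A ^ k).mulVec (x - y)‖)
    (fun x y h => by rwa [← neg_sub x y, Matrix.mulVec_neg, norm_neg])
    (fun x => by simp [hR.le]) G
    ⌈(volume G).toReal / (2 * κ) ^ Fintype.card n * unstableDet A ^ k⌉₊ with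
    ⟨P, hPG, hPc, hP⟩ | ⟨P, hPG, hPc, hP⟩
  · exact ⟨P, hPG, by rw [hPc]; exact Nat.le_ceil _, hP⟩
  · exfalso
    have hcov : G ⊆ ⋃ p ∈ P, (fun y => (H ^ k).mulVec y) ⁻¹'
        Metric.closedBall ((H ^ k).mulVec p) κ := by
      intro x hx
      obtain ⟨p, hp, hpx⟩ := hP x hx
      have hx0 : ‖x‖ ≤ |l| := by simpa using (hGl hx).trans (le_abs_self l)
      have hp0 : ‖p‖ ≤ |l| := by simpa using (hGl (hPG hp)).trans (le_abs_self l)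
      refine Set.mem_iUnion₂.mpr ⟨p, hp, ?_⟩
      rw [Set.mem_preimage, mem_closedBall_iff_norm', ← Matrix.mulVec_sub]
      have hHk : H ^ k = E * A ^ k + (1 - E) := by
        rw [← (hAE.pow_left k).eq, e1, ← e2, ← mul_add]; simp
      rw [hHk, Matrix.add_mulVec, ← Matrix.mulVec_mulVec]
      have h1 : ‖E.mulVec ((A ^ k).mulVec (p - x))‖ ≤ ‖E‖ * R :=
        (Matrix.linfty_opNorm_mulVec _ _).trans
          (mul_le_mul_of_nonneg_left (not_lt.mp hpx) (norm_nonneg _))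
      have h2 : ‖(1 - E).mulVec (p - x)‖ ≤ ‖1 - E‖ * (2 * |l|) :=
        (Matrix.linfty_opNorm_mulVec _ _).trans
          (mul_le_mul_of_nonneg_left ((norm_sub_le _ _).trans (by linarith)) (norm_nonneg _))
      have := norm_add_le (E.mulVec ((A ^ k).mulVec (p - x))) ((1 - E).mulVec (p - x))
      linarith
    have hle := (measure_mono (μ := volume) hcov).trans (measure_biUnion_finset_le P _)
    rw [Finset.sum_congr rfl fun x _ => volume_preimage_closedBall hdetk _ hκpos.le,
      Finset.sum_const, nsmul_eq_mul, ← ENNReal.ofReal_natCast,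
      ← ENNReal.ofReal_mul (by positivity)] at hle
    have hle' := ENNReal.toReal_mono ENNReal.ofReal_ne_top hle
    rw [ENNReal.toReal_ofReal (by positivity), Matrix.det_pow, abs_pow, hdet] at hle'
    have hlt := Nat.lt_ceil.mp hPc
    have hpk : 0 < unstableDet A ^ k := by positivity
    have hpk' : 0 < (2 * κ) ^ Fintype.card n := by positivity
    rw [div_mul_eq_mul_div, lt_div_iff₀ hpk'] at hlt
    rw [← mul_assoc, ← div_eq_mul_inv, div_mul_eq_mul_div, le_div_iff₀ hpk] at hle'
    linarith

end Packing

/-! ### Counting noise words; zero-error codes -/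

namespace AdditiveNoiseChannel

variable {S X : Type*} (K : AdditiveNoiseChannel S X)

/-- An infinite walk in the state graph of the channel. -/
def IsWalk (σ : ℕ → S) : Prop := ∀ t, K.Edge (σ t) (σ (t + 1))

theorem exists_edge (s : S) : ∃ s', K.Edge s s' := by
  obtain ⟨s', h, -⟩ := Relation.TransGen.head'_iff.mp (K.strongly_connected s s)
  exact ⟨s', h⟩

theorem exists_isWalk (s : S) : ∃ σ, K.IsWalk σ ∧ σ 0 = s := by
  choose f hf using K.exists_edge
  refine ⟨fun t => f^[t] s, fun t => ?_, rfl⟩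
  simp only [Function.iterate_succ_apply']
  exact hf _

variable {K} in
theorem IsWalk.shift {σ : ℕ → S} (h : K.IsWalk σ) (m : ℕ) : K.IsWalk fun t => σ (t + m) := by
  intro t
  have := h (t + m)
  rwa [add_right_comm] at this

variable {K} in
theorem IsWalk.isNoise {σ : ℕ → S} (h : K.IsWalk σ) :
    K.IsNoise fun t => K.label (σ t) (σ (t + 1)) :=
  ⟨σ, fun t => ⟨h t, rfl⟩⟩

variable [Fintype S]

open Classical in
/-- The noise words of length `T` produced by walks from `s`. -/
noncomputable def words (s : S) : (T : ℕ) → Finset (Fin T → X)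
  | 0 => {Fin.elim0}
  | T + 1 => (Finset.univ.filter fun s' => K.Edge s s').biUnion fun s' =>
      (words s' T).image fun w => (Fin.cons (K.label s s') w : Fin (T + 1) → X)

theorem mem_words_iff {s : S} {T : ℕ} {w : Fin T → X} :
    w ∈ K.words s T ↔ ∃ σ, K.IsWalk σ ∧ σ 0 = s ∧
      ∀ i : Fin T, w i = K.label (σ i) (σ (i + 1)) := by
  classical
  induction T generalizing s with
  | zero =>
    obtain ⟨σ, hσ, h0⟩ := K.exists_isWalk s
    simp only [words, Finset.mem_singleton]
    exact ⟨fun _ => ⟨σ, hσ, h0, fun i => i.elim0⟩, fun _ => Subsingleton.elim _ _⟩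
  | succ T ih =>
    simp only [words, Finset.mem_biUnion, Finset.mem_filter, Finset.mem_univ, true_and,
      Finset.mem_image]
    constructor
    · rintro ⟨s', hs', u, hu, rfl⟩
      obtain ⟨σ, hσ, h0, hl⟩ := ih.mp hu
      refine ⟨fun t => Nat.casesOn t s σ, ?_, rfl, ?_⟩
      · rintro (_ | t)
        · simpa [h0] using hs'
        · exact hσ t
      · intro i
        refine Fin.cases ?_ (fun i => ?_) i
        · simp [h0]
        · simpa using hl i
    · rintro ⟨σ, hσ, rfl, hl⟩
      refine ⟨σ 1, hσ 0, fun i => w i.succ, ih.mpr ⟨_, hσ.shift 1, rfl, fun i => ?_⟩, ?_⟩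
      · simpa using hl i.succ
      · funext i
        refine Fin.cases ?_ (fun i => ?_) i
        · simpa using (hl 0).symm
        · simp

theorem words_nonempty (s : S) (T : ℕ) : (K.words s T).Nonempty := by
  obtain ⟨σ, hσ, h0⟩ := K.exists_isWalk s
  exact ⟨fun i => K.label (σ i) (σ (i + 1)), K.mem_words_iff.mpr ⟨σ, hσ, h0, fun _ => rfl⟩⟩

open Classical in
-- Distinct edges from s carry distinct labels, so the words starting with different edges form
-- disjoint families, and counting words is counting walks.
theorem card_words_succ (s : S) (T : ℕ) :
    (K.words s (T + 1)).card = ∑ s', if K.Edge s s' then (K.words s' T).card else 0 := by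
  rw [words, Finset.card_biUnion, Finset.sum_filter]
  · refine Finset.sum_congr rfl fun s' _ => ?_
    split_ifs
    · exact Finset.card_image_of_injective _
        (Fin.cons_right_injective (α := fun _ : Fin (T + 1) => X) _)
    · rfl
  · intro s₁ h₁ s₂ h₂ hne
    refine Finset.disjoint_left.mpr fun w hw₁ hw₂ => hne ?_
    obtain ⟨u₁, -, rfl⟩ := Finset.mem_image.mp hw₁
    obtain ⟨u₂, -, h⟩ := Finset.mem_image.mp hw₂
    have h0 := congrFun h 0
    simp only [Fin.cons_zero] at h0
    exact K.label_injective s s₁ s₂ (Finset.mem_filter.mp h₁).2 (Finset.mem_filter.mp h₂).2 h0.symm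

theorem card_words_le_of_edge {s s' : S} (h : K.Edge s s') (T : ℕ) :
    (K.words s' T).card ≤ (K.words s (T + 1)).card := by
  classical
  rw [card_words_succ]
  have := Finset.single_le_sum (f := fun u => if K.Edge s u then (K.words u T).card else 0)
    (fun _ _ => Nat.zero_le _) (Finset.mem_univ s')
  simpa [h] using this

theorem card_words_mono (s : S) : Monotone fun T => (K.words s T).card := by
  classical
  refine monotone_nat_of_le_succ fun T => ?_
  have : K.words s T ⊆ (K.words s (T + 1)).image fun w => fun i : Fin T => w i.castSucc := by
    intro w hw
    obtain ⟨σ, hσ, h0, hl⟩ := K.mem_words_iff.mp hw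
    refine Finset.mem_image.mpr ⟨fun i => K.label (σ i) (σ (i + 1)),
      K.mem_words_iff.mpr ⟨σ, hσ, h0, fun _ => rfl⟩, ?_⟩
    funext i
    simp [hl i]
  exact (Finset.card_le_card this).trans Finset.card_image_le

/-- Zero-error codes of Gilbert–Varshamov type. -/
theorem exists_zero_error_code [Fintype X] [AddCommGroup X] [Nonempty S] {n N : ℕ} {B : ℝ}
    (hB : ∀ s, ((K.words s n).card : ℝ) ≤ B)
    (hN : N * (Fintype.card S * B) ^ 2 ≤ (Fintype.card X : ℝ) ^ n) :
    ∃ P : Finset (Fin n → X), P.card = N ∧ ∀ c ∈ P, ∀ c' ∈ P, ∀ s s', ∀ w ∈ K.words s n,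
      ∀ w' ∈ K.words s' n, c + w = c' + w' → c = c' := by
  classical
  set W : Finset (Fin n → X) := Finset.univ.biUnion fun s => K.words s n with hW
  have hWne : W.Nonempty := by
    obtain ⟨w, hw⟩ := K.words_nonempty (Classical.arbitrary S) n
    exact ⟨w, Finset.mem_biUnion.mpr ⟨_, Finset.mem_univ _, hw⟩⟩
  have hWcard : (W.card : ℝ) ≤ Fintype.card S * B := by
    have h1 : (W.card : ℝ) ≤ ∑ s : S, ((K.words s n).card : ℝ) := by
      exact_mod_cast Finset.card_biUnion_le
    have h2 := Finset.sum_le_sum fun s (_ : s ∈ Finset.univ) => hB s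
    simp only [Finset.sum_const, Finset.card_univ, nsmul_eq_mul] at h2
    linarith
  rcases exists_separated_or_cover (far := fun c c' : Fin n → X =>
      ∀ w ∈ W, ∀ w' ∈ W, c + w ≠ c' + w')
    (fun c c' h w hw w' hw' e => h w' hw' w hw e.symm)
    (fun c h => by
      obtain ⟨w, hw⟩ := hWne
      exact h w hw w hw rfl) Set.univ N with ⟨P, -, hP, hfar⟩ | ⟨P, -, hP, hcov⟩
  · refine ⟨P, hP, fun c hc c' hc' s s' w hw w' hw' e => ?_⟩
    by_contra hne
    exact hfar hc hc' hne w (Finset.mem_biUnion.mpr ⟨s, Finset.mem_univ _, hw⟩) w'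
      (Finset.mem_biUnion.mpr ⟨s', Finset.mem_univ _, hw'⟩) e
  · exfalso
    -- A maximal code with fewer than N words would make every word x equal to p + w - w' with p in
    -- the code and w, w' noise words, giving q^n < N |W|².
    have hsub : (Finset.univ : Finset (Fin n → X)) ⊆
        (P ×ˢ (W ×ˢ W)).image fun x => x.1 + x.2.1 - x.2.2 := by
      intro x _
      obtain ⟨p, hp, hpx⟩ := hcov x trivial
      push Not at hpx
      obtain ⟨w, hw, w', hw', e⟩ := hpx
      refine Finset.mem_image.mpr ⟨(p, w, w'), by simp [hp, hw, hw'], ?_⟩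
      simp [e]
    have h1 := (Finset.card_le_card hsub).trans Finset.card_image_le
    rw [Finset.card_univ, Finset.card_product, Finset.card_product, Fintype.card_fun,
      Fintype.card_fin] at h1
    have h2 : Fintype.card X ^ n < N * (W.card * W.card) :=
      h1.trans_lt (Nat.mul_lt_mul_of_pos_right hP (Nat.mul_pos hWne.card_pos hWne.card_pos))
    have h3 : (Fintype.card X : ℝ) ^ n < N * (W.card * W.card) := by exact_mod_cast h2
    have h4 : (N : ℝ) * (W.card * W.card) ≤ N * (Fintype.card S * B) ^ 2 := by
      rw [← sq]
      exact mul_le_mul_of_nonneg_left (pow_le_pow_left₀ (Nat.cast_nonneg _) hWcard 2)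
        (Nat.cast_nonneg _)
    linarith

variable [DecidableEq S]

theorem sum_norm_adjacency_pow (s : S) (T : ℕ) :
    ∑ s', ‖(K.adjacency ^ T) s s'‖ = (K.words s T).card := by
  classical
  set m : Matrix S S ℕ := Matrix.of fun s s' => if K.Edge s s' then 1 else 0 with hm
  have hA : K.adjacency = (Nat.castRingHom ℂ).mapMatrix m := by
    ext i j
    simp only [adjacency, hm, Matrix.of_apply, RingHom.mapMatrix_apply, Matrix.map_apply]
    split_ifs <;> simp
  have hsum : ∀ (T : ℕ) (s : S), ∑ s', (m ^ T) s s' = (K.words s T).card := by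
    intro T
    induction T with
    | zero => intro s; simp [words, Matrix.one_apply]
    | succ T ih =>
      intro s
      rw [card_words_succ]
      simp only [pow_succ', Matrix.mul_apply]
      rw [Finset.sum_comm]
      refine Finset.sum_congr rfl fun u _ => ?_
      rw [← Finset.mul_sum, ih, hm, Matrix.of_apply]
      split_ifs <;> simp
  rw [← hsum, hA, ← map_pow]
  simp

theorem card_words_le_norm (s : S) (T : ℕ) : ((K.words s T).card : ℝ) ≤ ‖K.adjacency ^ T‖ := by
  rw [← sum_norm_adjacency_pow, Matrix.linfty_opNorm_def]
  have := Finset.le_sup (f := fun i => ∑ j, ‖(K.adjacency ^ T) i j‖₊) (Finset.mem_univ s)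
  have h := NNReal.coe_le_coe.mpr this
  push_cast at h
  simpa only [coe_nnnorm] using h

theorem exists_card_words_eq_norm [Nonempty S] (T : ℕ) :
    ∃ s, ((K.words s T).card : ℝ) = ‖K.adjacency ^ T‖ := by
  obtain ⟨s, -, hs⟩ := Finset.exists_mem_eq_sup (Finset.univ : Finset S) Finset.univ_nonempty
    fun i => ∑ j, ‖(K.adjacency ^ T) i j‖₊
  refine ⟨s, ?_⟩
  rw [← sum_norm_adjacency_pow, Matrix.linfty_opNorm_def, hs]
  simp

/-- Some eigenvalue attains the spectral radius, and its T-th power is an eigenvalue of the T-th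
matrix power. -/
theorem perronEigenvalue_pow_le_norm [Nonempty S] (T : ℕ) :
    K.perronEigenvalue ^ T ≤ ‖K.adjacency ^ T‖ := by
  obtain ⟨z, hz, hzr⟩ := spectrum.exists_nnnorm_eq_spectralRadius K.adjacency
  have : K.perronEigenvalue = ‖z‖ := by
    rw [perronEigenvalue, ← hzr]; simp
  rw [this, ← norm_pow]
  exact spectrum.norm_le_norm_of_mem (spectrum.pow_mem_pow _ T hz)

/-- The norm bound holds for the best initial state, which may depend on T. By strong connectedness
it is reached from any s in a bounded number of steps, and prefixing such a path loses no words. -/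
theorem exists_perronEigenvalue_pow_le [Nonempty S] :
    ∃ k, ∀ s T, K.perronEigenvalue ^ T ≤ (K.words s (T + k)).card := by
  have h : ∀ p : S × S, ∃ k, ∀ T, (K.words p.2 T).card ≤ (K.words p.1 (T + k)).card := by
    rintro ⟨s, s'⟩
    induction K.strongly_connected s s' with
    | single h => exact ⟨1, K.card_words_le_of_edge h⟩
    | tail _ h ih =>
      obtain ⟨k, hk⟩ := ih
      refine ⟨k + 1, fun T => (K.card_words_le_of_edge h T).trans ((hk (T + 1)).trans_eq ?_)⟩
      rw [add_assoc, add_comm 1]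
  choose k hk using h
  refine ⟨∑ p, k p, fun s T => ?_⟩
  obtain ⟨s', hs'⟩ := K.exists_card_words_eq_norm T
  refine (K.perronEigenvalue_pow_le_norm T).trans (hs'.symm.le.trans ?_)
  have h1 : k (s, s') ≤ ∑ p, k p :=
    Finset.single_le_sum (f := k) (fun _ _ => Nat.zero_le _) (Finset.mem_univ _)
  exact_mod_cast (hk (s, s') T).trans (K.card_words_mono s (Nat.add_le_add_left h1 T))

variable [Fintype X]

/-- The growth rate of the number of noise words, `q ^ h_ch`. -/
noncomputable def growth : ℝ := (Fintype.card X : ℝ) ^ K.entropy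

variable [Nontrivial X]

theorem growth_pos : 0 < K.growth :=
  Real.rpow_pos_of_pos (by exact_mod_cast Fintype.card_pos) _

/-- The second alternative reflects the convention log 0 = 0; it occurs for empty S. -/
theorem growth_eq : K.growth = K.perronEigenvalue ∨ K.growth = 1 ∧ K.perronEigenvalue = 0 := by
  have hq : (1 : ℝ) < Fintype.card X := by exact_mod_cast Fintype.one_lt_card
  rcases (ENNReal.toReal_nonneg : 0 ≤ K.perronEigenvalue).eq_or_lt with h | h
  · right
    rw [growth, entropy, show K.perronEigenvalue = 0 from h.symm]
    simp
  · left
    exact Real.rpow_logb (by linarith) hq.ne' h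

theorem exists_growth_pow_le [Nonempty S] :
    ∃ k, ∀ s T, K.growth ^ T ≤ (K.words s (T + k)).card := by
  rcases K.growth_eq with h | ⟨h, -⟩
  · rw [h]; exact K.exists_perronEigenvalue_pow_le
  · rw [h]
    refine ⟨0, fun s T => ?_⟩
    rw [one_pow]
    exact_mod_cast (K.words_nonempty s _).card_pos

theorem exists_card_words_le {θ : ℝ} (hθ : 1 < θ) :
    ∃ C : ℝ, 0 < C ∧ ∀ s T, ((K.words s T).card : ℝ) ≤ C * (θ * K.growth) ^ T := by
  have hlt : K.perronEigenvalue < θ * K.growth := by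
    have := K.growth_pos
    rcases K.growth_eq with h | ⟨h, h0⟩
    · rw [← h]; nlinarith
    · rw [h0]; positivity
  have hfin : spectralRadius ℂ K.adjacency ≠ ⊤ := by
    rcases isEmpty_or_nonempty S with h | h
    · have : Subsingleton (Matrix S S ℂ) := inferInstance
      simp [spectralRadius, spectrum.of_subsingleton]
    · obtain ⟨z, -, hz⟩ := spectrum.exists_nnnorm_eq_spectralRadius K.adjacency
      rw [← hz]; exact ENNReal.coe_ne_top
  have hr : spectralRadius ℂ K.adjacency < ENNReal.ofReal (θ * K.growth) := by
    rw [← ENNReal.ofReal_toReal hfin]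
    exact (ENNReal.ofReal_lt_ofReal_iff (lt_of_le_of_lt ENNReal.toReal_nonneg hlt)).mpr hlt
  obtain ⟨C, hC, hb⟩ := exists_norm_pow_le hr
  exact ⟨C, hC, fun s T => (K.card_words_le_norm s T).trans (hb T)⟩

end AdditiveNoiseChannel

/-! ### The converse: bounded errors force h_lin + h_ch ≤ 1 -/

section Converse

open MeasureTheory

theorem LTISystem.rpow_entropy {nx ny : ℕ} (P : LTISystem nx ny) {q : ℕ} (hq : 1 < q) :
    (q : ℝ) ^ P.entropy q = unstableDet P.A := by
  classical
  have hq' : (1 : ℝ) < q := by exact_mod_cast hq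
  have h : P.entropy q = Real.logb q (unstableDet P.A) ∧ 1 ≤ unstableDet P.A := by
    unfold LTISystem.entropy unstableDet LTISystem.eigenvalues
    generalize (P.A.map ((↑) : ℝ → ℂ)).charpoly.roots = m
    induction m using Multiset.induction_on with
    | empty => simp
    | cons c m ih =>
      obtain ⟨ih1, ih2⟩ := ih
      rw [Multiset.map_cons, Multiset.prod_cons]
      refine ⟨?_, one_le_mul_of_one_le_of_one_le (le_max_left _ _) ih2⟩
      rw [Real.logb_mul (by positivity) (by positivity), ← ih1]
      by_cases hc : 1 ≤ ‖c‖
      · rw [Multiset.filter_cons_of_pos (p := fun μ : ℂ => 1 ≤ ‖μ‖) _ hc, Multiset.map_cons, Multiset.sum_cons,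
          max_eq_right hc]
      · rw [Multiset.filter_cons_of_neg (p := fun μ : ℂ => 1 ≤ ‖μ‖) _ hc, max_eq_left (not_le.mp hc).le]
        simp
  rw [h.1, Real.rpow_logb (by linarith) hq'.ne' (by linarith [h.2])]

theorem LTISystem.state_zero {nx ny : ℕ} (P : LTISystem nx ny) (x : Fin nx → ℝ) (t : ℕ) :
    P.state x 0 t = (P.A ^ t).mulVec x := by
  induction t with
  | zero => simp [LTISystem.state]
  | succ t ih => simp [LTISystem.state, ih, pow_succ']

theorem CoderEstimator.estimate_congr {nx ny : ℕ} {X : Type*} (F : CoderEstimator nx ny X)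
    {r r' : ℕ → X} {t : ℕ} (h : ∀ i < t, r i = r' i) : F.estimate r t = F.estimate r' t := by
  cases t with
  | zero => rfl
  | succ t =>
    simp only [CoderEstimator.estimate]
    congr 1
    funext i
    exact h i i.2

namespace AdditiveNoiseChannel

variable {S X : Type*} (K : AdditiveNoiseChannel S X)

/-- A causal functional that is bounded along every walk is uniformly bounded along the walks
with some common initial segment (Baire). -/
theorem exists_prefix_bounded [Finite S] [Nonempty S] (g : (ℕ → S) → ℕ → ℝ)
    (hg : ∀ t σ σ', (∀ i ≤ t, σ i = σ' i) → g σ t = g σ' t)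
    (hb : ∀ σ, K.IsWalk σ → ∃ M : ℝ, ∀ t, g σ t ≤ M) :
    ∃ (M m : ℕ) (σ₀ : ℕ → S), K.IsWalk σ₀ ∧
      ∀ σ, K.IsWalk σ → (∀ i < m, σ i = σ₀ i) → ∀ t, g σ t ≤ M := by
  let : TopologicalSpace S := ⊥
  have : DiscreteTopology S := ⟨rfl⟩
  have hclosed : ∀ (p : (ℕ → S) → Prop) (t : ℕ),
      (∀ σ σ', (∀ i ≤ t, σ i = σ' i) → (p σ ↔ p σ')) → IsClosed {σ | p σ} := by
    intro p t hp
    rw [← isOpen_compl_iff, isOpen_iff_forall_mem_open]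
    intro σ hσ
    refine ⟨PiNat.cylinder σ (t + 1), fun σ' hσ' => ?_, PiNat.isOpen_cylinder _ _ _,
      PiNat.self_mem_cylinder _ _⟩
    exact fun h => hσ ((hp σ' σ fun i hi => hσ' i (Nat.lt_succ_of_le hi)).mp h)
  have hwalk : IsClosed {σ | K.IsWalk σ} := by
    have : {σ | K.IsWalk σ} = ⋂ t, {σ : ℕ → S | K.Edge (σ t) (σ (t + 1))} := by
      ext σ; simp [IsWalk]
    rw [this]
    exact isClosed_iInter fun t => hclosed _ (t + 1) fun σ σ' h => by
      rw [h t (Nat.le_succ t), h (t + 1) le_rfl]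
  -- Walks form a closed subset of a product of finite discrete spaces, hence a compact Hausdorff,
  -- thus Baire, space. By causality the sublevel sets below are closed; one has interior and so
  -- contains a cylinder.
  have : CompactSpace {σ | K.IsWalk σ} := isCompact_iff_compactSpace.mp hwalk.isCompact
  obtain ⟨σ₁, hσ₁, -⟩ := K.exists_isWalk (Classical.arbitrary S)
  have : Nonempty {σ | K.IsWalk σ} := ⟨⟨σ₁, hσ₁⟩⟩
  obtain ⟨M, σ₀, U, ⟨hU, hUo⟩, hσ₀⟩ := nonempty_interior_of_iUnion_of_closed
    (f := fun M : ℕ => {σ : {σ | K.IsWalk σ} | ∀ t, g σ t ≤ M})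
    (fun M => by
      have : {σ : {σ | K.IsWalk σ} | ∀ t, g σ t ≤ M} =
          ⋂ t, Subtype.val ⁻¹' {σ : ℕ → S | g σ t ≤ M} := by
        ext σ; simp only [Set.mem_iInter]; rfl
      rw [this]
      exact isClosed_iInter fun t =>
        (hclosed _ t fun σ σ' h => by rw [hg t σ σ' h]).preimage continuous_subtype_val)
    (by
      refine Set.eq_univ_of_forall fun σ => ?_
      obtain ⟨M, hM⟩ := hb σ σ.2
      obtain ⟨k, hk⟩ := exists_nat_ge M
      exact Set.mem_iUnion.mpr ⟨k, fun t => (hM t).trans hk⟩)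
  obtain ⟨V, hV, rfl⟩ := isOpen_induced_iff.mp hU
  obtain ⟨-, ⟨x, m, rfl⟩, hx, hxV⟩ :=
    (PiNat.isTopologicalBasis_cylinders fun _ => S).exists_subset_of_mem_open hσ₀ hV
  refine ⟨M, m, σ₀, σ₀.2, fun σ hσ hm => ?_⟩
  exact hUo (a := ⟨σ, hσ⟩) (hxV fun i hi => (hm i hi).trans (hx i hi))

theorem exists_splice {σ₀ : ℕ → S} (hσ₀ : K.IsWalk σ₀) (m : ℕ) {τ : ℕ → S} (hτ : K.IsWalk τ)
    (h0 : τ 0 = σ₀ m) :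
    ∃ σ, K.IsWalk σ ∧ (∀ i ≤ m, σ i = σ₀ i) ∧ ∀ i, σ (m + i) = τ i := by
  have hle : ∀ i ≤ m, (if i < m then σ₀ i else τ (i - m)) = σ₀ i := by
    intro i hi
    rcases hi.lt_or_eq with h | rfl
    · simp [h]
    · simp [h0]
  refine ⟨fun i => if i < m then σ₀ i else τ (i - m), fun t => ?_, hle, fun i => by simp⟩
  by_cases h : t < m
  · simp only [hle t h.le, hle (t + 1) h]
    exact hσ₀ t
  · have h' : ¬ t + 1 < m := by omega
    simp only [h, h', if_false]
    rw [Nat.sub_add_comm (not_lt.mp h)]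
    exact hτ _

end AdditiveNoiseChannel

variable {nx ny : ℕ} {S X : Type*} [Fintype S] [Fintype X] [AddCommGroup X]

/-- If the errors are bounded on a set of initial states along all walks with a given initial
segment, then separated initial states and noise words produce distinct received words. -/
theorem card_mul_card_words_le (P : LTISystem nx ny) (K : AdditiveNoiseChannel S X)
    (F : CoderEstimator nx ny X) {σ₀ : ℕ → S} (hσ₀ : K.IsWalk σ₀) (m T : ℕ) {M : ℝ}
    {Q : Finset (Fin nx → ℝ)}
    (hQ : ∀ x ∈ Q, ∀ σ, K.IsWalk σ → (∀ i < m, σ i = σ₀ i) →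
      ∀ t, ‖F.error P x 0 0 (fun t => K.label (σ t) (σ (t + 1))) t‖ ≤ M)
    (hsep : (Q : Set (Fin nx → ℝ)).Pairwise fun x y => 2 * M < ‖(P.A ^ (m + T)).mulVec (x - y)‖) :
    Q.card * (K.words (σ₀ m) T).card ≤ Fintype.card X ^ (m + T) := by
  classical
  have : Nonempty S := ⟨σ₀ 0⟩
  have hz : ∀ w ∈ K.words (σ₀ m) T, ∃ σ, K.IsWalk σ ∧ (∀ i ≤ m, σ i = σ₀ i) ∧
      ∀ i : Fin T, w i = K.label (σ (m + i)) (σ (m + i + 1)) := by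
    intro w hw
    obtain ⟨τ, hτ, h0, hl⟩ := K.mem_words_iff.mp hw
    obtain ⟨σ, hσ, h1, h2⟩ := K.exists_splice hσ₀ m hτ h0
    exact ⟨σ, hσ, h1, fun i => by rw [hl, h2, add_assoc, h2]⟩
  choose! ω hω hpre hlab using hz
  set r : (Fin nx → ℝ) → (Fin T → X) → ℕ → X := fun x w =>
    F.channelOutput (P.output x 0 0) fun t => K.label (ω w t) (ω w (t + 1)) with hr
  -- Equal received words give equal estimates at time m + T, so separation forces x = x'. Then the
  -- channel inputs agree and cancel, leaving equal noise.
  have hinj : Set.InjOn (fun p : (Fin nx → ℝ) × (Fin T → X) =>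
      fun i : Fin (m + T) => r p.1 p.2 i) (Q ×ˢ K.words (σ₀ m) T : Finset _) := by
    rintro ⟨x, w⟩ hxw ⟨x', w'⟩ hxw' h
    rw [Finset.mem_coe, Finset.mem_product] at hxw hxw'
    have hrr : ∀ i < m + T, r x w i = r x' w' i := fun i hi => congrFun h ⟨i, hi⟩
    have hx : x = x' := by
      by_contra hne
      have h1 := hQ x hxw.1 (ω w) (hω w hxw.2) (fun i hi => hpre w hxw.2 i hi.le) (m + T)
      have h2 := hQ x' hxw'.1 (ω w') (hω w' hxw'.2) (fun i hi => hpre w' hxw'.2 i hi.le) (m + T)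
      have h3 := hsep hxw.1 hxw'.1 hne
      have h4 := F.estimate_congr hrr
      rw [CoderEstimator.error, P.state_zero] at h1 h2
      change ‖_ - F.estimate (r x w) (m + T)‖ ≤ M at h1
      change ‖_ - F.estimate (r x' w') (m + T)‖ ≤ M at h2
      rw [← h4] at h2
      have h5 := norm_sub_le_norm_sub_add_norm_sub ((P.A ^ (m + T)).mulVec x)
        (F.estimate (r x w) (m + T)) ((P.A ^ (m + T)).mulVec x')
      rw [norm_sub_rev (F.estimate (r x w) (m + T)), ← Matrix.mulVec_sub] at h5
      linarith
    subst hx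
    refine Prod.ext rfl (funext fun i => ?_)
    have h1 := hrr (m + i) (by omega)
    simp only [hr, CoderEstimator.channelOutput, add_right_inj] at h1
    change w i = w' i
    rw [hlab w hxw.2 i, hlab w' hxw'.2 i]
    exact h1
  have := Finset.card_le_card_of_injOn (t := (Finset.univ : Finset (Fin (m + T) → X))) _
    (fun _ _ => Finset.mem_coe.mpr (Finset.mem_univ _)) hinj
  rwa [Finset.card_product, Finset.card_univ, Fintype.card_fun, Fintype.card_fin] at this

theorem exists_unbounded_error [DecidableEq S] [Nonempty S] [Nontrivial X]
    (P : LTISystem nx ny) (K : AdditiveNoiseChannel S X)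
    (h : 1 < P.entropy (Fintype.card X) + K.entropy) (F : CoderEstimator nx ny X)
    {l : ℝ} (hl : 0 < l) :
    ∃ x₀ ∈ Metric.closedBall (0 : Fin nx → ℝ) l, ∃ z : ℕ → X, K.IsNoise z ∧
      ∀ M : ℝ, ∃ t, M < ‖F.error P x₀ 0 0 z t‖ := by
  by_contra hcon
  push Not at hcon
  set g : (Fin nx → ℝ) → (ℕ → S) → ℕ → ℝ := fun x σ t =>
    ‖F.error P x 0 0 (fun t => K.label (σ t) (σ (t + 1))) t‖ with hg
  have hcausal : ∀ x t σ σ', (∀ i ≤ t, σ i = σ' i) → g x σ t = g x σ' t := by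
    intro x t σ σ' hσ
    simp only [hg, CoderEstimator.error]
    rw [F.estimate_congr (r' := F.channelOutput (P.output x 0 0)
      fun t => K.label (σ' t) (σ' (t + 1))) fun i hi => ?_]
    simp only [CoderEstimator.channelOutput]
    rw [hσ i hi.le, hσ (i + 1) hi]
  -- Bound and prefix range over a countable index set, so one of these sets has positive outer
  -- measure. Requiring a walk with the prefix lets one be extracted from a point of that set.
  let G : (ℕ × Σ m : ℕ, (Fin m → S)) → Set (Fin nx → ℝ) := fun p =>
    {x | x ∈ Metric.closedBall (0 : Fin nx → ℝ) l ∧ (∃ σ₀, K.IsWalk σ₀ ∧ ∀ i, σ₀ i.1 = p.2.2 i) ∧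
      ∀ σ, K.IsWalk σ → (∀ i, σ i.1 = p.2.2 i) → ∀ t, g x σ t ≤ p.1}
  have hcover : Metric.closedBall (0 : Fin nx → ℝ) l ⊆ ⋃ p, G p := by
    intro x hx
    obtain ⟨M, m, σ₀, hσ₀, hb⟩ := K.exists_prefix_bounded (g x) (hcausal x)
      fun σ hσ => hcon x hx _ hσ.isNoise
    exact Set.mem_iUnion.mpr ⟨⟨M, m, fun i => σ₀ i⟩, hx, ⟨σ₀, hσ₀, fun _ => rfl⟩,
      fun σ hσ hi => hb σ hσ fun i him => hi ⟨i, him⟩⟩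
  obtain ⟨⟨M, m, p⟩, hGp⟩ : ∃ p, volume (G p) ≠ 0 := by
    by_contra hnull
    push Not at hnull
    have h0 := measure_mono_null hcover (measure_iUnion_null hnull)
    exact (Metric.measure_closedBall_pos volume (0 : Fin nx → ℝ) hl).ne' h0
  obtain ⟨x₁, hx₁⟩ := nonempty_of_measure_ne_zero hGp
  obtain ⟨-, ⟨σ₀, hσ₀, hp⟩, -⟩ := hx₁
  obtain ⟨c, hc, hsep⟩ := exists_separated_image P.A (G := G ⟨M, m, p⟩) (fun x hx => hx.1) hGp
    (R := 2 * M + 1) (by positivity)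
  obtain ⟨k₀, hk₀⟩ := K.exists_growth_pow_le
  have hq1 : 1 < Fintype.card X := Fintype.one_lt_card
  have hq : (1 : ℝ) < Fintype.card X := by exact_mod_cast hq1
  have hD := one_le_unstableDet P.A
  have hΛ := K.growth_pos
  set q : ℝ := ((Fintype.card X : ℕ) : ℝ) with hqdef
  have hrate : q < unstableDet P.A * K.growth := by
    rw [← P.rpow_entropy hq1, AdditiveNoiseChannel.growth, ← Real.rpow_add (by linarith)]
    conv_lhs => rw [← Real.rpow_one q]
    exact Real.rpow_lt_rpow_of_exponent_lt hq h
  -- The prefix length m and the delay k₀ are fixed, so they change only the constants, not the rate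
  -- comparison.
  have hcount : ∀ k : ℕ, c * unstableDet P.A ^ (m + k₀) * (unstableDet P.A * K.growth) ^ k ≤
      q ^ (m + k₀) * q ^ k := by
    intro k
    obtain ⟨Q, hQG, hQc, hQs⟩ := hsep (m + (k + k₀))
    have h1 := card_mul_card_words_le P K F hσ₀ m (k + k₀) (M := M) (Q := Q)
      (fun x hx σ hσ hi => (hQG hx).2.2 σ hσ fun i => (hi i i.2).trans (hp i))
      (fun x hx y hy hxy => lt_trans (by linarith) (hQs hx hy hxy))
    have h2 : (Q.card : ℝ) * (K.words (σ₀ m) (k + k₀)).card ≤ q ^ (m + (k + k₀)) := by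
      rw [hqdef]; exact_mod_cast h1
    calc c * unstableDet P.A ^ (m + k₀) * (unstableDet P.A * K.growth) ^ k
        = c * unstableDet P.A ^ (m + (k + k₀)) * K.growth ^ k := by
          rw [mul_pow]; ring
      _ ≤ Q.card * (K.words (σ₀ m) (k + k₀)).card :=
          mul_le_mul hQc (hk₀ _ _) (by positivity) (by positivity)
      _ ≤ q ^ (m + (k + k₀)) := h2
      _ = _ := by ring
  have hratio : 1 < unstableDet P.A * K.growth / q := (one_lt_div (by linarith)).mpr hrate
  obtain ⟨k, hk⟩ := pow_unbounded_of_one_lt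
    (q ^ (m + k₀) / (c * unstableDet P.A ^ (m + k₀))) hratio
  have hpos : 0 < c * unstableDet P.A ^ (m + k₀) := by positivity
  have hqk : 0 < q ^ k := by positivity
  rw [div_pow, div_lt_div_iff₀ hpos hqk] at hk
  have := hcount k
  linarith

end Converse

/-! ### Error-free block transmission of quantizer cells -/

namespace AdditiveNoiseChannel

variable {S X : Type*} [Fintype S] [Fintype X] [AddCommGroup X]

/-- A zero-error encoder-decoder pair for any message set not larger than a zero-error code. -/
theorem exists_zero_error_encoding (K : AdditiveNoiseChannel S X) [Nonempty S] {n N : ℕ} {B : ℝ}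
    (hB : ∀ s, ((K.words s n).card : ℝ) ≤ B)
    (hN : N * (Fintype.card S * B) ^ 2 ≤ (Fintype.card X : ℝ) ^ n)
    {μ : Type*} [Fintype μ] [Nonempty μ] (hμ : Fintype.card μ ≤ N) :
    ∃ (enc : μ → Fin n → X) (dec : (Fin n → X) → μ),
      ∀ m s, ∀ w ∈ K.words s n, dec (enc m + w) = m := by
  classical
  obtain ⟨P, hP, hcode⟩ := K.exists_zero_error_code hB hN
  obtain ⟨e⟩ : Nonempty (μ ↪ P) :=
    Function.Embedding.nonempty_of_card_le (by rwa [Fintype.card_coe, hP])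
  refine ⟨fun m => (e m).1, fun r => if h : ∃ m s, ∃ w ∈ K.words s n, (e m).1 + w = r then h.choose
    else Classical.arbitrary μ, fun m s w hw => ?_⟩
  have h : ∃ m' s', ∃ w' ∈ K.words s' n, (e m').1 + w' = (e m).1 + w := ⟨m, s, w, hw, rfl⟩
  simp only [dif_pos h]
  obtain ⟨s', w', hw', he⟩ := h.choose_spec
  exact e.injective (Subtype.ext (hcode _ (e _).2 _ (e m).2 s' s w' hw' w hw he))

end AdditiveNoiseChannel

section BlockCode

variable {n : Type*} [Fintype n] [DecidableEq n]
variable {S X : Type*} [Fintype S] [DecidableEq S] [Nonempty S] [Fintype X] [Nontrivial X]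
  [AddCommGroup X]

/-- If `q ^ (h_lin + 2 h_ch) < q`, then for some large block length the cells of a quantizer
contracting `A ^ k` can be transmitted without error, together with an overflow symbol. -/
theorem exists_block_quantizer (A : Matrix n n ℝ) (K : AdditiveNoiseChannel S X)
    (h : unstableDet A * K.growth ^ 2 < Fintype.card X) (k₀ : ℕ) :
    ∃ k ≥ k₀, ∃ (Q : Finset (n → ℝ)) (enc : Option Q → Fin k → X) (dec : (Fin k → X) → Option Q),
      (∀ b : n → ℝ, ‖b‖ ≤ 1 → ∃ a : Q, ‖(A ^ k).mulVec b - a‖ ≤ 1 / 2) ∧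
      ∀ m s, ∀ w ∈ K.words s k, dec (enc m + w) = m := by
  classical
  have hΔ := one_le_unstableDet A
  have hΛ := K.growth_pos
  have hpos : 0 < unstableDet A * K.growth ^ 2 := by positivity
  -- One factor θ is spent on the cell count and two on the squared word count; the fourth keeps the
  -- rate strictly below q.
  obtain ⟨θ, hθ, hθ4⟩ := exists_one_lt_pow_le ((one_lt_div hpos).mpr h) 4
  rw [le_div_iff₀ hpos] at hθ4
  obtain ⟨C₁, hC₁, hb₁⟩ := card_separated_image_le A hθ
  obtain ⟨C₂, hC₂, hb₂⟩ := K.exists_card_words_le hθ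
  set q : ℝ := ((Fintype.card X : ℕ) : ℝ) with hq
  have hq0 : 0 < q := hpos.trans h
  have hrate : θ ^ 3 * (unstableDet A * K.growth ^ 2) / q < 1 := by
    rw [div_lt_one hq0]
    refine lt_of_lt_of_le ?_ hθ4
    exact mul_lt_mul_of_pos_right (pow_lt_pow_right₀ hθ (by norm_num)) hpos
  have hlim := tendsto_pow_atTop_nhds_zero_of_lt_one (by positivity) hrate
  have hCpos : 0 < (C₁ + 1) * (Fintype.card S * C₂) ^ 2 := by
    have : 0 < (Fintype.card S : ℝ) := by exact_mod_cast Fintype.card_pos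
    positivity
  obtain ⟨k, hk, hkk₀⟩ := ((hlim.eventually_lt_const (inv_pos.mpr hCpos)).and
    (Filter.eventually_ge_atTop k₀)).exists
  refine ⟨k, hkk₀, ?_⟩
  -- This exceeds every separated set, so the cover alternative must hold. The cover has fewer than
  -- N cells, which leaves room for the overflow symbol.
  set N : ℕ := ⌊C₁ * (θ * unstableDet A) ^ k⌋₊ + 1 with hN
  have hone : 1 ≤ (θ * unstableDet A) ^ k :=
    one_le_pow₀ (one_le_mul_of_one_le_of_one_le hθ.le hΔ)
  have hNle : (N : ℝ) ≤ (C₁ + 1) * (θ * unstableDet A) ^ k := by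
    have := Nat.floor_le (show 0 ≤ C₁ * (θ * unstableDet A) ^ k by positivity)
    rw [hN]; push_cast
    linarith
  have hbudget : N * (Fintype.card S * (C₂ * (θ * K.growth) ^ k)) ^ 2 ≤ q ^ k := by
    rw [div_pow, div_lt_iff₀ (by positivity), inv_mul_eq_div, lt_div_iff₀ hCpos] at hk
    calc N * (Fintype.card S * (C₂ * (θ * K.growth) ^ k)) ^ 2
        ≤ (C₁ + 1) * (θ * unstableDet A) ^ k *
          (Fintype.card S * (C₂ * (θ * K.growth) ^ k)) ^ 2 := by gcongr
      _ = (θ ^ 3 * (unstableDet A * K.growth ^ 2)) ^ k *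
          ((C₁ + 1) * (Fintype.card S * C₂) ^ 2) := by
          simp only [mul_pow, ← pow_mul]
          ring
      _ ≤ q ^ k := hk.le
  rcases exists_separated_or_cover (far := fun x y : n → ℝ => 1 / 2 < ‖x - y‖)
    (fun x y h => by rwa [norm_sub_rev]) (fun x => by simp)
    ((fun b => (A ^ k).mulVec b) '' Metric.closedBall 0 1) N with
    ⟨P, hPG, hP, hfar⟩ | ⟨P, hPG, hP, hcov⟩
  · exfalso
    have h1 := hb₁ k P (fun x hx => by
      obtain ⟨b, hb, rfl⟩ := hPG hx
      exact ⟨b, by simpa using hb, rfl⟩) hfar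
    have h2 := Nat.lt_floor_add_one (C₁ * (θ * unstableDet A) ^ k)
    rw [hP, hN] at h1
    push_cast at h1
    linarith
  · obtain ⟨enc, dec, hed⟩ := K.exists_zero_error_encoding (fun s => hb₂ s k) hbudget
      (μ := Option P) (by rw [Fintype.card_option, Fintype.card_coe]; omega)
    refine ⟨P, enc, dec, fun b hb => ?_, hed⟩
    obtain ⟨p, hp, hpb⟩ := hcov _ ⟨b, by simpa using hb, rfl⟩
    exact ⟨⟨p, hp⟩, by rw [norm_sub_rev]; exact not_lt.mp hpb⟩

end BlockCode

/-! ### The zooming quantizer -/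

section ZoomingQuantizer

variable {n : Type*} [Fintype n] {α : Type*} (B : Matrix n n ℝ) (a : α → n → ℝ)

/-- The zoom factor of the quantizer. -/
noncomputable def zoom : ℝ := 2 * (‖B‖ + 1)

/-- State update of the quantizer with state (centre, zoom level) on receiving a cell index or
the overflow symbol. -/
noncomputable def quantizerStep (s : (n → ℝ) × ℕ) : Option α → (n → ℝ) × ℕ
  | some i => (B.mulVec s.1 + zoom B ^ s.2 • a i, s.2)
  | none => (B.mulVec s.1, s.2 + 1)

open Classical in
/-- The symbol sent by the quantizer in state `s` for the value `ξ`. -/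
noncomputable def quantize (s : (n → ℝ) × ℕ) (ξ : n → ℝ) : Option α :=
  if h : ∃ i, ‖B.mulVec (ξ - s.1) - zoom B ^ s.2 • a i‖ ≤ 1 / 2 * zoom B ^ s.2 then
    some h.choose else none

/-- Quantizer state of the estimator after the first `k` symbols of `m`. -/
noncomputable def decoderState (m : ℕ → Option α) : ℕ → (n → ℝ) × ℕ
  | 0 => (0, 0)
  | k + 1 => quantizerStep B a (decoderState m k) (m k)

/-- Quantizer state of the coder before processing the `k`-th value of `ξ`. -/
noncomputable def encoderState (ξ : ℕ → n → ℝ) : ℕ → (n → ℝ) × ℕ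
  | 0 => (0, 0)
  | k + 1 => quantizerStep B a (encoderState ξ k) (quantize B a (encoderState ξ k) (ξ k))

/-- The symbol sent for the `k`-th value of `ξ`. -/
noncomputable def quantizerSymbol (ξ : ℕ → n → ℝ) (k : ℕ) : Option α :=
  quantize B a (encoderState B a ξ k) (ξ k)

theorem encoderState_congr {ξ ξ' : ℕ → n → ℝ} {k : ℕ} (h : ∀ i < k, ξ i = ξ' i) :
    encoderState B a ξ k = encoderState B a ξ' k := by
  induction k with
  | zero => rfl
  | succ k ih =>
    simp only [encoderState]
    rw [ih fun i hi => h i (hi.trans (Nat.lt_succ_self k)), h k (Nat.lt_succ_self k)]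

theorem quantizerSymbol_congr {ξ ξ' : ℕ → n → ℝ} {k : ℕ} (h : ∀ i ≤ k, ξ i = ξ' i) :
    quantizerSymbol B a ξ k = quantizerSymbol B a ξ' k := by
  rw [quantizerSymbol, quantizerSymbol, encoderState_congr B a fun i hi => h i hi.le, h k le_rfl]

theorem decoderState_eq_encoderState {m : ℕ → Option α} {ξ : ℕ → n → ℝ} {k : ℕ}
    (h : ∀ i < k, m i = quantizerSymbol B a ξ i) :
    decoderState B a m k = encoderState B a ξ k := by
  induction k with
  | zero => rfl
  | succ k ih =>
    simp only [encoderState, decoderState]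
    rw [ih fun i hi => h i (hi.trans (Nat.lt_succ_self k)), h k (Nat.lt_succ_self k),
      quantizerSymbol]

/-- With g = ‖B‖ + 1 and zoom factor 2g, the error at level j is at most (2g)^j / 2 + D g^j. A hit
restores this directly; an overflow multiplies the error by at most g - 1 and adds at most D, which
level j + 1 absorbs. Overflow needs an error above (2g)^j, hence 2^j < 2D, so the level never passes
a J depending only on D. -/
theorem exists_quantizer_error_le
    (ha : ∀ b : n → ℝ, ‖b‖ ≤ 1 → ∃ i, ‖B.mulVec b - a i‖ ≤ 1 / 2) {D : ℝ} (hD : 0 < D) :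
    ∃ E : ℝ, ∀ ξ : ℕ → n → ℝ, ‖ξ 0‖ ≤ D → (∀ k, ‖ξ (k + 1) - B.mulVec (ξ k)‖ ≤ D) →
      ∀ k, ‖ξ k - (encoderState B a ξ k).1‖ ≤ E := by
  set g : ℝ := ‖B‖ + 1 with hg
  have hg1 : 1 ≤ g := by have := norm_nonneg B; linarith
  have hz : zoom B = 2 * g := rfl
  have hz0 : 0 < zoom B := by rw [hz]; positivity
  obtain ⟨J, hJ⟩ := pow_unbounded_of_one_lt (2 * D) (one_lt_two (α := ℝ))
  refine ⟨1 / 2 * zoom B ^ J + D * g ^ J, fun ξ h0 hξ k => ?_⟩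
  suffices h : ‖ξ k - (encoderState B a ξ k).1‖ ≤
      1 / 2 * zoom B ^ (encoderState B a ξ k).2 + D * g ^ (encoderState B a ξ k).2 ∧
      (encoderState B a ξ k).2 ≤ J by
    refine h.1.trans ?_
    have h1 : zoom B ^ (encoderState B a ξ k).2 ≤ zoom B ^ J :=
      pow_le_pow_right₀ (by rw [hz]; linarith) h.2
    have h2 : g ^ (encoderState B a ξ k).2 ≤ g ^ J := pow_le_pow_right₀ hg1 h.2
    have := mul_le_mul_of_nonneg_left h2 hD.le
    linarith
  induction k with
  | zero =>
    simp only [encoderState, sub_zero, pow_zero, mul_one]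
    exact ⟨by linarith, Nat.zero_le _⟩
  | succ k ih =>
    simp only [encoderState]
    set s := encoderState B a ξ k with hs
    obtain ⟨ih1, ih2⟩ := ih
    have hgs : 1 ≤ g ^ s.2 := one_le_pow₀ hg1
    have hDg : D ≤ D * g ^ s.2 := le_mul_of_one_le_right hD.le hgs
    have hzs : 0 < zoom B ^ s.2 := by positivity
    by_cases hcell : ∃ i, ‖B.mulVec (ξ k - s.1) - zoom B ^ s.2 • a i‖ ≤ 1 / 2 * zoom B ^ s.2
    · rw [quantize, dif_pos hcell]
      simp only [quantizerStep]
      refine ⟨?_, ih2⟩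
      have h1 : ∀ i, ξ (k + 1) - (B.mulVec s.1 + zoom B ^ s.2 • a i) =
          (ξ (k + 1) - B.mulVec (ξ k)) + (B.mulVec (ξ k - s.1) - zoom B ^ s.2 • a i) := by
        intro i
        rw [Matrix.mulVec_sub]; abel
      rw [h1]
      have h2 := norm_add_le (ξ (k + 1) - B.mulVec (ξ k))
        (B.mulVec (ξ k - s.1) - zoom B ^ s.2 • a hcell.choose)
      have h3 := hξ k
      have h4 := hcell.choose_spec
      linarith
    · rw [quantize, dif_neg hcell]
      simp only [quantizerStep]
      have hover : zoom B ^ s.2 < ‖ξ k - s.1‖ := by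
        by_contra hle
        apply hcell
        obtain ⟨i, hi⟩ := ha ((zoom B ^ s.2)⁻¹ • (ξ k - s.1)) (by
          rw [norm_smul, norm_inv, Real.norm_of_nonneg hzs.le, inv_mul_le_one₀ hzs]
          exact not_lt.mp hle)
        refine ⟨i, ?_⟩
        have h1 : B.mulVec (ξ k - s.1) - zoom B ^ s.2 • a i =
            zoom B ^ s.2 • (B.mulVec ((zoom B ^ s.2)⁻¹ • (ξ k - s.1)) - a i) := by
          rw [Matrix.mulVec_smul, smul_sub, smul_inv_smul₀ hzs.ne']
        rw [h1, norm_smul, Real.norm_of_nonneg hzs.le, mul_comm]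
        exact mul_le_mul_of_nonneg_right hi hzs.le
      have hzg : zoom B ^ s.2 = 2 ^ s.2 * g ^ s.2 := by rw [hz, mul_pow]
      constructor
      · have h1 : ξ (k + 1) - B.mulVec s.1 =
            (ξ (k + 1) - B.mulVec (ξ k)) + B.mulVec (ξ k - s.1) := by
          rw [Matrix.mulVec_sub]; abel
        have h2 := norm_add_le (ξ (k + 1) - B.mulVec (ξ k)) (B.mulVec (ξ k - s.1))
        have h3 := hξ k
        have h4 : ‖B.mulVec (ξ k - s.1)‖ ≤
            (g - 1) * (1 / 2 * zoom B ^ s.2 + D * g ^ s.2) := by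
          refine (Matrix.linfty_opNorm_mulVec _ _).trans ?_
          rw [show ‖B‖ = g - 1 by rw [hg]; ring]
          exact mul_le_mul_of_nonneg_left ih1 (by linarith)
        rw [h1, pow_succ, pow_succ]
        have h5 : zoom B ^ s.2 * zoom B = 2 * (g * zoom B ^ s.2) := by rw [hz]; ring
        have h6 : 0 ≤ g * zoom B ^ s.2 := by positivity
        rw [h5]
        nlinarith
      · by_contra hJs
        have hJeq : s.2 = J := by omega
        rw [hJeq] at hover ih1 hzg
        have hgJ : 0 < g ^ J := by positivity
        nlinarith

end ZoomingQuantizer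

/-! ### Reconstructing the state from a window of outputs -/

section Observer

variable {nx ny : ℕ} (P : LTISystem nx ny)

theorem LTISystem.Observable.exists_reconstruction (h : P.Observable) :
    ∃ (N : ℕ) (g : (Fin N → Fin ny → ℝ) →ₗ[ℝ] (Fin nx → ℝ)),
      ∀ x, g (fun i => P.C.mulVec ((P.A ^ (i : ℕ)).mulVec x)) = x := by
  let L : ℕ → (Fin nx → ℝ) →ₗ[ℝ] (Fin ny → ℝ) := fun k => (P.C * P.A ^ k).mulVecLin
  have hL : ∀ k x, L k x = P.C.mulVec ((P.A ^ k).mulVec x) := fun k x => by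
    simp [L, Matrix.mulVec_mulVec]
  -- The kernels of the first N output maps decrease and hence stabilise; observability makes the
  -- limit trivial, so a finite window of outputs is injective in the state.
  let f : ℕ →o (Submodule ℝ (Fin nx → ℝ))ᵒᵈ :=
    ⟨fun N => OrderDual.toDual (⨅ k : Fin N, LinearMap.ker (L k)), fun N N' hN => by
      refine OrderDual.toDual_le_toDual.mpr (le_iInf fun k => ?_)
      exact iInf_le (fun k : Fin N' => LinearMap.ker (L k)) ⟨k, k.2.trans_le hN⟩⟩
  obtain ⟨N, hN⟩ := IsArtinian.monotone_stabilizes f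
  let T : (Fin nx → ℝ) →ₗ[ℝ] (Fin N → Fin ny → ℝ) := LinearMap.pi fun k => L k
  have hT : LinearMap.ker T = ⊥ := by
    rw [LinearMap.ker_eq_bot']
    intro x hx
    have hxN : x ∈ (⨅ k : Fin N, LinearMap.ker (L k)) := by
      simp only [Submodule.mem_iInf, LinearMap.mem_ker]
      exact fun k => congrFun hx k
    refine h x fun k => ?_
    have hk := hN (max N (k + 1)) (le_max_left _ _)
    have hx' : x ∈ (⨅ j : Fin (max N (k + 1)), LinearMap.ker (L j)) := by
      have h1 : (⨅ k : Fin N, LinearMap.ker (L k)) =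
        ⨅ j : Fin (max N (k + 1)), LinearMap.ker (L j) := hk
      rwa [h1] at hxN
    simp only [Submodule.mem_iInf, LinearMap.mem_ker] at hx'
    rw [← hL]
    exact hx' ⟨k, lt_of_lt_of_le (Nat.lt_succ_self k) (le_max_right _ _)⟩
  obtain ⟨g, hg⟩ := T.exists_leftInverse_of_injective hT
  refine ⟨N, g, fun x => ?_⟩
  have h1 := LinearMap.congr_fun hg x
  have h2 : T x = fun i : Fin N => P.C.mulVec ((P.A ^ (i : ℕ)).mulVec x) := by
    funext i; exact hL i x
  rw [LinearMap.comp_apply, h2] at h1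
  exact h1

theorem LTISystem.norm_state_add_sub_le {x₀ : Fin nx → ℝ} {v : ℕ → Fin nx → ℝ} {b : ℝ}
    (hv : ∀ t, ‖v t‖ ≤ b) (t i : ℕ) :
    ‖P.state x₀ v (t + i) - (P.A ^ i).mulVec (P.state x₀ v t)‖ ≤
      b * ∑ j ∈ Finset.range i, ‖P.A‖ ^ j := by
  induction i with
  | zero => simp
  | succ i ih =>
    have h1 : P.state x₀ v (t + (i + 1)) - (P.A ^ (i + 1)).mulVec (P.state x₀ v t) =
        P.A.mulVec (P.state x₀ v (t + i) - (P.A ^ i).mulVec (P.state x₀ v t)) + v (t + i) := by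
      rw [← add_assoc, LTISystem.state, Matrix.mulVec_sub, Matrix.mulVec_mulVec, ← pow_succ']
      abel
    rw [h1]
    refine (norm_add_le _ _).trans ?_
    have h2 := (Matrix.linfty_opNorm_mulVec P.A _).trans
      (mul_le_mul_of_nonneg_left ih (norm_nonneg P.A))
    have h3 := hv (t + i)
    have h4 : ∑ j ∈ Finset.range (i + 1), ‖P.A‖ ^ j =
        ‖P.A‖ * ∑ j ∈ Finset.range i, ‖P.A‖ ^ j + 1 := by
      rw [Finset.sum_range_succ', Finset.mul_sum, pow_zero]
      simp only [pow_succ']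
    rw [h4]
    linarith

/-- Over a window of fixed length the disturbances move the outputs by a bounded amount,
independently of t and of the size of the state, and g is Lipschitz. -/
theorem LTISystem.exists_observation_error_le {N : ℕ}
    {g : (Fin N → Fin ny → ℝ) →ₗ[ℝ] (Fin nx → ℝ)}
    (hg : ∀ x, g (fun i => P.C.mulVec ((P.A ^ (i : ℕ)).mulVec x)) = x) {b b' : ℝ} (hb : 0 ≤ b)
    (hb' : 0 ≤ b') :
    ∃ ε : ℝ, 0 ≤ ε ∧ ∀ x₀ v w, (∀ t, ‖v t‖ ≤ b) → (∀ t, ‖w t‖ ≤ b') →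
      ∀ t, ‖g (fun i => P.output x₀ v w (t + i)) - P.state x₀ v t‖ ≤ ε := by
  set β : ℝ := b * ∑ j ∈ Finset.range N, ‖P.A‖ ^ j with hβ
  have hβ0 : 0 ≤ β := by positivity
  refine ⟨‖LinearMap.toContinuousLinearMap g‖ * (‖P.C‖ * β + b'), by positivity,
    fun x₀ v w hv hw t => ?_⟩
  conv_lhs => rw [← hg (P.state x₀ v t)]
  rw [← map_sub]
  refine ((LinearMap.toContinuousLinearMap g).le_opNorm _).trans
    (mul_le_mul_of_nonneg_left ?_ (norm_nonneg _))
  refine (pi_norm_le_iff_of_nonneg (by positivity)).mpr fun i => ?_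
  have h1 : P.output x₀ v w (t + i) - P.C.mulVec ((P.A ^ (i : ℕ)).mulVec (P.state x₀ v t)) =
      P.C.mulVec (P.state x₀ v (t + i) - (P.A ^ (i : ℕ)).mulVec (P.state x₀ v t)) +
        w (t + i) := by
    rw [LTISystem.output, Matrix.mulVec_sub]; abel
  rw [Pi.sub_apply, h1]
  refine (norm_add_le _ _).trans (add_le_add ?_ (hw _))
  refine (Matrix.linfty_opNorm_mulVec _ _).trans
    (mul_le_mul_of_nonneg_left ((P.norm_state_add_sub_le hv t i).trans ?_) (norm_nonneg _))
  refine mul_le_mul_of_nonneg_left ?_ hb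
  exact Finset.sum_le_sum_of_subset_of_nonneg
    (Finset.range_subset_range.mpr i.2.le) fun _ _ _ => by positivity

end Observer

/-! ### The block coder-estimator and its error bound -/

section BlockScheme

/-- Extension of a finite sequence by zero. -/
def extendZero {E : Type*} [Zero E] {m : ℕ} (y : Fin m → E) (i : ℕ) : E :=
  if h : i < m then y ⟨i, h⟩ else 0

theorem extendZero_restrict {E : Type*} [Zero E] {m i : ℕ} (y : ℕ → E) (h : i < m) :
    extendZero (fun j : Fin m => y j) i = y i := by
  simp [extendZero, h]

variable {nx ny : ℕ} {X α : Type*} [AddCommGroup X] {N k : ℕ}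

/-- State reconstructions at the block starts. -/
def blockObservation (k : ℕ) (g : (Fin N → Fin ny → ℝ) →ₗ[ℝ] (Fin nx → ℝ))
    (y : ℕ → Fin ny → ℝ) (j : ℕ) : Fin nx → ℝ :=
  g fun i => y (j * k + i)

/-- Block scheme: in block `j + 1` the coder sends the quantizer symbol of the state at the start
of block `j`; the estimator propagates the latest decoded centre. -/
noncomputable def blockScheme (A : Matrix (Fin nx) (Fin nx) ℝ) (hk : 0 < k)
    (g : (Fin N → Fin ny → ℝ) →ₗ[ℝ] (Fin nx → ℝ)) (a : α → Fin nx → ℝ)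
    (enc : Option α → Fin k → X) (dec : (Fin k → X) → Option α) : CoderEstimator nx ny X where
  -- The first block is filler: the first state reconstruction is available only once that block's
  -- outputs are known.
  coder t y := if t < k then 0 else
    enc (quantizerSymbol (A ^ k) a (blockObservation k g (extendZero y)) (t / k - 1))
      ⟨t % k, Nat.mod_lt t hk⟩
  -- Of the (t + 1) / k completed blocks the first carries no symbol. Truncated subtraction keeps
  -- the index at 0, with centre 0, until a symbol is complete.
  estimator t r := (A ^ (t + 1 - ((t + 1) / k - 1) * k)).mulVec
    (decoderState (A ^ k) a (fun j => dec fun i => extendZero r ((j + 1) * k + i))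
      ((t + 1) / k - 1)).1

variable {A : Matrix (Fin nx) (Fin nx) ℝ} {hk : 0 < k}
  {g : (Fin N → Fin ny → ℝ) →ₗ[ℝ] (Fin nx → ℝ)} {a : α → Fin nx → ℝ}
  {enc : Option α → Fin k → X} {dec : (Fin k → X) → Option α}

theorem blockScheme_channelInput (hN : N ≤ k) (y : ℕ → Fin ny → ℝ) (j : ℕ) (i : Fin k) :
    (blockScheme A hk g a enc dec).channelInput y ((j + 1) * k + i) =
      enc (quantizerSymbol (A ^ k) a (blockObservation k g y) j) i := by
  have hdiv : ((j + 1) * k + i) / k - 1 = j := by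
    rw [add_comm, Nat.add_mul_div_right _ _ hk, Nat.div_eq_of_lt i.2]
    omega
  have hmod : ((j + 1) * k + i) % k = i := by
    rw [add_comm, Nat.add_mul_mod_self_right, Nat.mod_eq_of_lt i.2]
  have hge : ¬ (j + 1) * k + i < k := by
    rw [add_mul, one_mul]; omega
  simp only [CoderEstimator.channelInput, blockScheme, if_neg hge]
  rw [quantizerSymbol_congr (A ^ k) a (ξ' := blockObservation k g y) fun l hl => ?_]
  · simp only [hdiv, hmod]
  · rw [hdiv] at hl
    -- Since N ≤ k, the observation windows up to block j end before block j + 1 starts, so the zero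
    -- padding of the output history is never read.
    simp only [blockObservation]
    congr 1
    funext m
    apply extendZero_restrict
    have h1 : l * k ≤ j * k := Nat.mul_le_mul_right k hl
    have h2 := m.2
    rw [add_mul, one_mul]
    omega

theorem blockScheme_estimate {S : Type*} [Fintype S] {K : AdditiveNoiseChannel S X} (hN : N ≤ k)
    (hdec : ∀ m s, ∀ w ∈ K.words s k, dec (enc m + w) = m) (y : ℕ → Fin ny → ℝ) {z : ℕ → X}
    (hz : K.IsNoise z) (t : ℕ) :
    (blockScheme A hk g a enc dec).estimate
        ((blockScheme A hk g a enc dec).channelOutput y z) t =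
      (A ^ (t - (t / k - 1) * k)).mulVec
        (encoderState (A ^ k) a (blockObservation k g y) (t / k - 1)).1 := by
  cases t with
  | zero => simp [CoderEstimator.estimate, encoderState]
  | succ t =>
    simp only [CoderEstimator.estimate]
    change (A ^ (t + 1 - ((t + 1) / k - 1) * k)).mulVec (decoderState (A ^ k) a _ _).1 = _
    rw [decoderState_eq_encoderState (A ^ k) a fun j hj => ?_]
    obtain ⟨σ, hσ⟩ := hz
    have hw : (fun i : Fin k => z ((j + 1) * k + i)) ∈ K.words (σ ((j + 1) * k)) k := by
      have hwalk : K.IsWalk σ := fun t => (hσ t).1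
      refine K.mem_words_iff.mpr ⟨_, hwalk.shift ((j + 1) * k), by simp, fun i => ?_⟩
      rw [(hσ _).2, add_right_comm _ 1, add_comm]
    conv_rhs => rw [← hdec (quantizerSymbol (A ^ k) a (blockObservation k g y) j) _ _ hw]
    congr 1
    funext i
    rw [extendZero_restrict]
    · simp only [CoderEstimator.channelOutput, Pi.add_apply]
      rw [blockScheme_channelInput hN]
    · have h1 : (j + 2) * k ≤ (t + 1) / k * k := Nat.mul_le_mul_right k (by omega)
      have h2 := Nat.div_mul_le_self (t + 1) k
      have h3 := i.2
      have h4 : (j + 2) * k = (j + 1) * k + k := by ring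
      omega

end BlockScheme

theorem exists_uniformlyBounded {nx ny : ℕ} {S X : Type*} [Fintype S] [DecidableEq S] [Nonempty S]
    [Fintype X] [Nontrivial X] [AddCommGroup X] (P : LTISystem nx ny)
    (K : AdditiveNoiseChannel S X) (hobs : P.Observable)
    (h : P.entropy (Fintype.card X) + 2 * K.entropy < 1) :
    ∃ F : CoderEstimator nx ny X, F.UniformlyBounded P K := by
  have hq1 : 1 < Fintype.card X := Fintype.one_lt_card
  have hq : (1 : ℝ) < Fintype.card X := by exact_mod_cast hq1
  have hrate : unstableDet P.A * K.growth ^ 2 < Fintype.card X := by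
    rw [← P.rpow_entropy hq1, AdditiveNoiseChannel.growth, ← Real.rpow_natCast,
      ← Real.rpow_mul (by linarith), ← Real.rpow_add (by linarith)]
    conv_rhs => rw [← Real.rpow_one (Fintype.card X : ℝ)]
    refine Real.rpow_lt_rpow_of_exponent_lt hq ?_
    push_cast
    linarith
  obtain ⟨N, g, hg⟩ := hobs.exists_reconstruction
  -- A block of length at least N + 1 is nonempty and contains the whole observation window.
  obtain ⟨k, hkN, Q, enc, dec, hcell, hdec⟩ := exists_block_quantizer P.A K hrate (N + 1)
  have hk : 0 < k := by omega
  have hNk : N ≤ k := by omega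
  refine ⟨blockScheme P.A hk g (fun a : Q => (a : Fin nx → ℝ)) enc dec, ?_⟩
  rintro 𝒱 𝒲 ⟨h0v, b, hb⟩ ⟨h0w, b', hb'⟩
  have hb0 : 0 ≤ b := (norm_nonneg _).trans (hb 0 h0v 0)
  have hb0' : 0 ≤ b' := (norm_nonneg _).trans (hb' 0 h0w 0)
  obtain ⟨ε, hε, hobs⟩ := P.exists_observation_error_le hg hb0 hb0'
  set β : ℕ → ℝ := fun i => b * ∑ j ∈ Finset.range i, ‖P.A‖ ^ j with hβ
  have hβ0 : ∀ i, 0 ≤ β i := fun i => by positivity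
  have hβmono : ∀ {i j}, i ≤ j → β i ≤ β j := fun hij =>
    mul_le_mul_of_nonneg_left (Finset.sum_le_sum_of_subset_of_nonneg
      (Finset.range_subset_range.mpr hij) fun _ _ _ => by positivity) hb0
  -- D covers the initial measured state, 1 + ε, and the one-block innovation: drift β k plus
  -- observation errors at both ends. It enters only the analysis; the scheme was fixed before the
  -- ranges.
  obtain ⟨E, hE⟩ := exists_quantizer_error_le (P.A ^ k) (fun a : Q => (a : Fin nx → ℝ)) hcell
    (D := 1 + ε + β k + ‖P.A ^ k‖ * ε) (by have := hβ0 k; positivity)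
  refine ⟨1, one_pos, fun R₀ hR₀ => ⟨(∑ s ∈ Finset.range (2 * k), ‖P.A ^ s‖) * (ε + E) +
    β (2 * k), fun x₀ hx₀ v hv w hw z hz t => ?_⟩⟩
  have hobs' := hobs x₀ v w (hb v hv) (hb' w hw)
  have hdrift := P.norm_state_add_sub_le (x₀ := x₀) (hb v hv)
  set ξ := blockObservation k g (P.output x₀ v w) with hξ
  have hξe : ∀ j, ‖ξ j - P.state x₀ v (j * k)‖ ≤ ε := fun j => hobs' (j * k)
  have hnn : 0 ≤ ‖P.A ^ k‖ * ε := by positivity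
  have hquant := hE ξ
    (by
      have h1 := hξe 0
      have h2 : ‖x₀‖ ≤ 1 := by simpa using hR₀ hx₀
      rw [zero_mul, LTISystem.state] at h1
      have h3 := norm_add_le (ξ 0 - x₀) x₀
      rw [sub_add_cancel] at h3
      linarith [hβ0 k])
    (fun j => by
      have h1 := hξe (j + 1)
      have h2 := hdrift (j * k) k
      have h3 : ‖(P.A ^ k).mulVec (P.state x₀ v (j * k) - ξ j)‖ ≤ ‖P.A ^ k‖ * ε :=
        (Matrix.linfty_opNorm_mulVec _ _).trans
          (mul_le_mul_of_nonneg_left (by rw [norm_sub_rev]; exact hξe j) (norm_nonneg _))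
      have h4 : ξ (j + 1) - (P.A ^ k).mulVec (ξ j) =
          (ξ (j + 1) - P.state x₀ v ((j + 1) * k)) +
          (P.state x₀ v (j * k + k) - (P.A ^ k).mulVec (P.state x₀ v (j * k))) +
          (P.A ^ k).mulVec (P.state x₀ v (j * k) - ξ j) := by
        rw [Matrix.mulVec_sub, show (j + 1) * k = j * k + k by ring]; abel
      rw [h4]
      refine norm_add₃_le.trans ?_
      change _ ≤ β k at h2
      linarith)
  set κ := t / k - 1 with hκ
  have hκt : κ * k ≤ t := (Nat.mul_le_mul_right k (Nat.sub_le _ _)).trans (Nat.div_mul_le_self t k)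
  -- The decoded centre is less than two blocks old, so propagating it costs only finitely many
  -- powers of A.
  have hs : t - κ * k < 2 * k := by
    have h1 := Nat.lt_div_mul_add (a := t) hk
    have h2 : t / k * k ≤ (κ + 1) * k := Nat.mul_le_mul_right k (by omega)
    have h3 : (κ + 1) * k = κ * k + k := by ring
    omega
  set s := t - κ * k with hsdef
  have hts : t = κ * k + s := by omega
  rw [CoderEstimator.error, blockScheme_estimate hNk hdec _ hz, ← hκ, ← hsdef, ← hξ]
  set c := (encoderState (P.A ^ k) (fun a : Q => (a : Fin nx → ℝ)) ξ κ).1 with hc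
  have hdec2 : P.state x₀ v t - (P.A ^ s).mulVec c =
      (P.A ^ s).mulVec ((P.state x₀ v (κ * k) - ξ κ) + (ξ κ - c)) +
        (P.state x₀ v (κ * k + s) - (P.A ^ s).mulVec (P.state x₀ v (κ * k))) := by
    rw [sub_add_sub_cancel, Matrix.mulVec_sub, ← hts]; abel
  have hA : ‖P.A ^ s‖ ≤ ∑ s ∈ Finset.range (2 * k), ‖P.A ^ s‖ :=
    Finset.single_le_sum (f := fun s => ‖P.A ^ s‖) (fun _ _ => norm_nonneg _)
      (Finset.mem_range.mpr hs)
  rw [hdec2]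
  refine (norm_add_le _ _).trans (add_le_add ?_ ?_)
  · refine (Matrix.linfty_opNorm_mulVec _ _).trans
      (mul_le_mul hA ?_ (norm_nonneg _) (Finset.sum_nonneg fun _ _ => norm_nonneg _))
    refine (norm_add_le _ _).trans (add_le_add ?_ (hquant κ))
    rw [norm_sub_rev]
    exact hξe κ
  · exact (hdrift (κ * k) s).trans (hβmono hs.le)

end FSEstimation

theorem proposition3 {nx ny : ℕ} {S X : Type*} [Fintype S] [DecidableEq S] [Nonempty S]
    [Fintype X] [Nontrivial X] [AddCommGroup X]
    (P : FSEstimation.LTISystem nx ny) (K : FSEstimation.AdditiveNoiseChannel S X)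
    (hobs : P.Observable) (hunst : P.HasUnstableEigenvalue) :
    (P.entropy (Fintype.card X) + 2 * K.entropy < 1 →
      ∃ F : FSEstimation.CoderEstimator nx ny X, F.UniformlyBounded P K) ∧
    (1 < P.entropy (Fintype.card X) + K.entropy →
      ∀ (F : FSEstimation.CoderEstimator nx ny X)
        (𝒱 : Set (ℕ → Fin nx → ℝ)) (𝒲 : Set (ℕ → Fin ny → ℝ)),
        FSEstimation.AdmissibleRange 𝒱 → FSEstimation.AdmissibleRange 𝒲 →
        ∀ l : ℝ, 0 < l →
          ∃ v ∈ 𝒱, ∃ w ∈ 𝒲, ∃ x₀ ∈ Metric.closedBall (0 : Fin nx → ℝ) l,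
            ∃ z : ℕ → X, K.IsNoise z ∧ ∀ M : ℝ, ∃ t, M < ‖F.error P x₀ v w z t‖) :=
  ⟨FSEstimation.exists_uniformlyBounded P K hobs, fun h F _ _ h𝒱 h𝒲 _ hl =>
    ⟨0, h𝒱.1, 0, h𝒲.1, FSEstimation.exists_unbounded_error P K h F hl⟩⟩
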